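/- Let $R$ be a commutative ring and let $\mathfrak{S}Sym=\bigoplus_{n\ge 0}R\mathfrak{S}_n$ be the Malvenuto–Reutenauer Hopf algebra, whose basis is the set of all permutations (in one-line notation), with product $\pi\,\overline{\sqcup\!\sqcup}\,\sigma=\sum_{\tau\in\pi \sqcup\!\sqcup (\sigma+m)}\tau$ for $\pi\in\mathfrak{S}_m$ (shifted shuffle, shuffles counted with multiplicity) and coproduct $\Delta(\pi)=\sum_{i=0}^{m}\mathrm{st}(\pi_1\cdots\pi_i)\otimes \mathrm{st}(\pi_{i+1}\cdots\pi_m)$, where $\mathrm{st}$ is standardization. Let $S$ be its antipode. For $A\subseteq[n]$ let $\sigma_A\in\mathfrak{S}_n$ be the permutation whose one-line notation lists the elements of $A$ in decreasing order followed by the elements of $[n]\setminus A$ in increasing order. For integers $k,l$ let $\eta_{k,l}$ be the increasing word $k(k+1)\cdots l$ and $\delta_{l,k}$ the decreasing word $l(l-1)\cdots k$ if $k\le l$; both are the empty word if $k=l+1$, and both are $0$ if $k\ge l+2$. Concatenation and the shuffle product $\sqcup\!\sqcup$ of words are extended bilinearly, concatenation takes precedence over $\sqcup\!\sqcup$, and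 empty sums are $0$. (1) Let $1<a\le n$ and $A=\{a\}$. Then $\sigma_{\{a\}}=\sigma_{\{1,a\}}$ and $$S(\sigma_A)=(-1)^{n-1}(2 \sqcup\!\sqcup \delta_{n,4})31+(-1)^{n+a}\big((a-1)\eta_{1,a-2} \sqcup\!\sqcup \delta_{n,a+1}\big)a+\sum_{j=2}^{a-1}(-1)^{n+j}\Big[\big((j-1)\eta_{1,j-2} \sqcup\!\sqcup \delta_{n,j+1}\big)j+\big((j+1)\eta_{1,j-1} \sqcup\!\sqcup \delta_{n,j+2}\big)j\Big].$$ (2) Let $2<a\le n$ and $A=\{a,2\}$. Then $$S(\sigma_A)=(-1)^{n}\big[(32 \sqcup\!\sqcup \delta_{n,5})41+(12 \sqcup\!\sqcup \delta_{n,4})3\big]+(-1)^{n-1}\big(1 \sqcup\!\sqcup (3 \sqcup\!\sqcup \delta_{n,5})4\big)2+\sum_{j=3}^{a-1}(-1)^{n+j}\Big[\big((j+1)21\eta_{3,j-1} \sqcup\!\sqcup \delta_{n,j+2}\big)j-\big(j21\eta_{3,j-1} \sqcup\!\sqcup \delta_{n,j+2}\big)(j+1)\Big].$$ Both formulas are cancellation-free: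 when the right-hand side is expanded into signed words, no word occurs with both signs. -/

import Mathlib

/-! ### Words, shuffles and standardization -/

namespace MalvenutoReutenauer

open scoped TensorProduct

/-- The shuffles of two words, counted with multiplicity:
`au ⧢ bv = a (u ⧢ bv) + b (au ⧢ v)`, and the empty word is neutral. -/
def shuffle : List ℕ → List ℕ → Multiset (List ℕ)
  | [], v => {v}
  | a :: u, [] => {a :: u}
  | a :: u, b :: v =>
      (shuffle u (b :: v)).map (List.cons a) + (shuffle (a :: u) v).map (List.cons b)
termination_by u v => u.length + v.length

/-- The word `w + m`. -/
def shift (m : ℕ) (w : List ℕ) : List ℕ := w.map (· + m)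

/-- The standardization of a word without repeated letters: each letter is replaced by its rank
among the letters of the word. -/
def standardize (w : List ℕ) : List ℕ := w.map fun x => w.countP (· ≤ x)

/-- `w` is the one-line notation of a permutation of `{1, …, n}`, where `n` is its length. -/
def IsPermWord (w : List ℕ) : Prop := w.Perm (List.range' 1 w.length)

/-- The set `𝔖` of all permutations of all the sets `{1, …, n}`, `n ≥ 0`, in one-line notation. -/
@[ext]
structure PermWord where
  /-- The one-line notation. -/
  word : List ℕ
  /-- It is a rearrangement of `1 2 ⋯ n`. -/
  isPermWord : IsPermWord word

lemma shuffle_nil_right (u : List ℕ) : shuffle u [] = {u} := by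
  cases u <;> simp [shuffle]

lemma shuffle_nil_left (u : List ℕ) : shuffle [] u = {u} := by
  simp [shuffle]

lemma perm_append_of_mem_shuffle (u v w : List ℕ) (h : w ∈ shuffle u v) : w.Perm (u ++ v) := by
  induction u, v using shuffle.induct generalizing w with
  | case1 v => simp [shuffle] at h; simp [h]
  | case2 a u => simp [shuffle] at h; simp [h]
  | case3 a u b v ih1 ih2 =>
    rw [shuffle, Multiset.mem_add, Multiset.mem_map, Multiset.mem_map] at h
    rcases h with ⟨x, hx, rfl⟩ | ⟨x, hx, rfl⟩
    · exact (ih1 x hx).cons a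
    · exact ((ih2 x hx).cons b).trans List.perm_middle.symm

lemma isPermWord_iff (w : List ℕ) : IsPermWord w ↔ w.Nodup ∧ ∀ x ∈ w, 1 ≤ x ∧ x ≤ w.length := by
  constructor
  · intro h
    refine ⟨h.nodup_iff.2 List.nodup_range', fun x hx => ?_⟩
    have := h.mem_iff.1 hx
    simp at this
    omega
  · rintro ⟨h1, h2⟩
    have : w.Subperm (List.range' 1 w.length) := List.subperm_of_subset h1 fun x hx => by
      have := h2 x hx
      simp
      omega
    exact this.perm_of_length_le (by simp)

lemma IsPermWord.nodup {w : List ℕ} (h : IsPermWord w) : w.Nodup := ((isPermWord_iff w).1 h).1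

lemma IsPermWord.le {w : List ℕ} (h : IsPermWord w) {x : ℕ} (hx : x ∈ w) : x ≤ w.length :=
  (((isPermWord_iff w).1 h).2 x hx).2

lemma IsPermWord.pos {w : List ℕ} (h : IsPermWord w) {x : ℕ} (hx : x ∈ w) : 1 ≤ x :=
  (((isPermWord_iff w).1 h).2 x hx).1

lemma isPermWord_nil : IsPermWord [] := by simp [IsPermWord]

lemma isPermWord_append_shift {u v : List ℕ} (hu : IsPermWord u) (hv : IsPermWord v) :
    IsPermWord (u ++ shift u.length v) := by
  rw [isPermWord_iff]
  constructor
  · rw [List.nodup_append]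
    refine ⟨hu.nodup, hv.nodup.map (add_left_injective _), fun a ha b hb => ?_⟩
    have := hu.le ha
    obtain ⟨y, hy, rfl⟩ := List.mem_map.1 hb
    have := hv.pos hy
    omega
  · intro x hx
    rcases List.mem_append.1 hx with h | h
    · have := hu.le h
      have := hu.pos h
      simp
      omega
    · obtain ⟨y, hy, rfl⟩ := List.mem_map.1 h
      have := hv.pos hy
      have := hv.le hy
      simp [shift]
      omega

lemma isPermWord_of_mem_shuffle {u v w : List ℕ} (hu : IsPermWord u) (hv : IsPermWord v)
    (h : w ∈ shuffle u (shift u.length v)) : IsPermWord w := by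
  have h1 := perm_append_of_mem_shuffle _ _ _ h
  have h2 := isPermWord_append_shift hu hv
  unfold IsPermWord at *
  rw [h1.length_eq]
  exact h1.trans h2

lemma countP_lt_countP {w : List ℕ} {x y : ℕ} (hy : y ∈ w) (h : x < y) :
    w.countP (· ≤ x) < w.countP (· ≤ y) := by
  induction w with
  | nil => simp at hy
  | cons a w ih =>
    have hmono : w.countP (· ≤ x) ≤ w.countP (· ≤ y) :=
      List.countP_mono_left fun z _ hz => by simp at *; omega
    rw [List.countP_cons, List.countP_cons]
    rcases List.mem_cons.1 hy with rfl | hy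
    · simp
      split_ifs <;> omega
    · have := ih hy
      simp
      split_ifs <;> omega

lemma countP_le_iff {w : List ℕ} {x y : ℕ} (hx : x ∈ w) :
    w.countP (· ≤ x) ≤ w.countP (· ≤ y) ↔ x ≤ y := by
  constructor
  · intro h
    by_contra h'
    exact absurd (countP_lt_countP hx (not_le.1 h')) (not_lt.2 h)
  · intro h
    exact List.countP_mono_left fun z _ hz => by simp at *; omega

lemma isPermWord_standardize {w : List ℕ} (hw : w.Nodup) : IsPermWord (standardize w) := by
  rw [isPermWord_iff]
  constructor
  · refine List.Nodup.map_on (fun x hx y hy h => ?_) hw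
    exact le_antisymm ((countP_le_iff hx).1 h.le) ((countP_le_iff hy).1 h.ge)
  · intro x hx
    obtain ⟨y, hy, rfl⟩ := List.mem_map.1 hx
    refine ⟨?_, by simpa [standardize] using List.countP_le_length⟩
    exact List.countP_pos_iff.2 ⟨y, hy, by simp⟩

lemma standardize_map (f : ℕ → ℕ) (w : List ℕ) (hf : ∀ x ∈ w, ∀ y ∈ w, f x ≤ f y ↔ x ≤ y) :
    standardize (w.map f) = standardize w := by
  simp only [standardize, List.map_map]
  refine List.map_congr_left fun x hx => ?_
  simp only [Function.comp, List.countP_map]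
  exact List.countP_congr fun y hy => by simpa using hf y hy x hx

lemma standardize_standardize_of_sublist {u w : List ℕ} (h : ∀ x ∈ u, x ∈ w) :
    standardize (u.map fun x => w.countP (· ≤ x)) = standardize u :=
  standardize_map _ _ fun x hx _ _ => countP_le_iff (h x hx)

lemma countP_range' (n x : ℕ) (h : x ≤ n) : (List.range' 1 n).countP (· ≤ x) = x := by
  induction n with
  | zero => simp; omega
  | succ n ih =>
    rw [List.range'_1_concat, List.countP_append]
    rcases Nat.lt_or_ge n x with h1 | h1
    · have : (List.range' 1 n).countP (· ≤ x) = (List.range' 1 n).length :=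
        List.countP_eq_length.2 fun y hy => by
          have := List.mem_range'_1.1 hy
          simp
          omega
      rw [this, List.length_range', show x = n + 1 by omega]
      simp [Nat.add_comm]
    · rw [ih h1]
      simp
      omega

lemma standardize_eq_self {w : List ℕ} (h : IsPermWord w) : standardize w = w := by
  conv_rhs => rw [← List.map_id w]
  refine List.map_congr_left fun x hx => ?_
  rw [List.Perm.countP_eq _ h, countP_range' _ _ (h.le hx)]
  rfl

namespace PermWord

/-- The empty permutation. -/
def empty : PermWord := ⟨[], isPermWord_nil⟩

/-- The length of a permutation. -/
def length (p : PermWord) : ℕ := p.1.length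

/-- `st(σ₁ ⋯ σᵢ)`. -/
def stTake (p : PermWord) (i : ℕ) : PermWord :=
  ⟨standardize (p.1.take i), isPermWord_standardize (p.2.nodup.sublist (List.take_sublist _ _))⟩

/-- `st(σᵢ₊₁ ⋯ σₙ)`. -/
def stDrop (p : PermWord) (i : ℕ) : PermWord :=
  ⟨standardize (p.1.drop i), isPermWord_standardize (p.2.nodup.sublist (List.drop_sublist _ _))⟩

lemma length_stTake (p : PermWord) (i : ℕ) : (p.stTake i).length = min i p.length := by
  simp [stTake, length, standardize]

lemma length_stDrop (p : PermWord) (i : ℕ) : (p.stDrop i).length = p.length - i := by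
  simp [stDrop, length, standardize]

lemma eq_empty {p : PermWord} (h : p.length = 0) : p = empty :=
  PermWord.ext (List.length_eq_zero_iff.1 h)

lemma stTake_length (p : PermWord) : p.stTake p.length = p :=
  PermWord.ext (by simp [stTake, length, standardize_eq_self p.2])

lemma stDrop_zero (p : PermWord) : p.stDrop 0 = p :=
  PermWord.ext (by simp [stDrop, standardize_eq_self p.2])

lemma stTake_zero (p : PermWord) : p.stTake 0 = empty :=
  PermWord.ext (by simp [stTake, standardize, empty])

lemma stDrop_length (p : PermWord) : p.stDrop p.length = empty :=
  PermWord.ext (by simp [stDrop, standardize, empty, length])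

lemma stTake_stTake (p : PermWord) (i j : ℕ) (h : j ≤ i) : (p.stTake i).stTake j = p.stTake j := by
  apply PermWord.ext
  simp only [stTake]
  conv_lhs => rw [standardize.eq_def (List.take i p.1), ← List.map_take]
  rw [standardize_standardize_of_sublist fun x hx => List.mem_of_mem_take hx, List.take_take,
    min_eq_left h]

lemma stDrop_stDrop (p : PermWord) (i j : ℕ) : (p.stDrop i).stDrop j = p.stDrop (i + j) := by
  apply PermWord.ext
  simp only [stDrop]
  conv_lhs => rw [standardize.eq_def (List.drop i p.1), ← List.map_drop]
  rw [standardize_standardize_of_sublist fun x hx => List.mem_of_mem_drop hx, List.drop_drop]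

lemma stDrop_stTake (p : PermWord) (i j : ℕ) :
    (p.stTake (i + j)).stDrop i = (p.stDrop i).stTake j := by
  apply PermWord.ext
  simp only [stDrop, stTake]
  conv_lhs => rw [standardize.eq_def (List.take _ p.1), ← List.map_drop]
  conv_rhs => rw [standardize.eq_def (List.drop _ p.1), ← List.map_take]
  rw [standardize_standardize_of_sublist fun x hx => List.mem_of_mem_drop hx,
    standardize_standardize_of_sublist fun x hx => List.mem_of_mem_take hx, List.drop_take]
  simp

end PermWord

/-! ### Sums over shuffles and over deconcatenations -/

section Sums

variable {M : Type*} [AddCommMonoid M]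

/-- The sum of `F w` over the shuffles `w` of `u` and `v`. -/
def shSum (u v : List ℕ) (F : List ℕ → M) : M := ((shuffle u v).map F).sum

/-- The sum of `G u v` over the factorizations `w = uv`. -/
def decSum (w : List ℕ) (G : List ℕ → List ℕ → M) : M :=
  ∑ i ∈ Finset.range (w.length + 1), G (w.take i) (w.drop i)

lemma shSum_nil_left (v : List ℕ) (F : List ℕ → M) : shSum [] v F = F v := by
  simp [shSum, shuffle]

lemma shSum_nil_right (v : List ℕ) (F : List ℕ → M) : shSum v [] F = F v := by
  simp [shSum, shuffle_nil_right]

lemma shSum_cons_cons (a b : ℕ) (u v : List ℕ) (F : List ℕ → M) :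
    shSum (a :: u) (b :: v) F =
      shSum u (b :: v) (fun w => F (a :: w)) + shSum (a :: u) v (fun w => F (b :: w)) := by
  simp [shSum, shuffle]

lemma shSum_add (u v : List ℕ) (F G : List ℕ → M) :
    shSum u v (fun w => F w + G w) = shSum u v F + shSum u v G := by
  simp [shSum, Multiset.sum_map_add]

lemma shSum_congr {u v : List ℕ} {F G : List ℕ → M}
    (h : ∀ w, w.Perm (u ++ v) → F w = G w) : shSum u v F = shSum u v G := by
  unfold shSum
  rw [Multiset.map_congr rfl fun w hw => h w (perm_append_of_mem_shuffle _ _ _ hw)]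

lemma decSum_add (w : List ℕ) (F G : List ℕ → List ℕ → M) :
    decSum w (fun u v => F u v + G u v) = decSum w F + decSum w G := by
  simp [decSum, Finset.sum_add_distrib]

lemma decSum_cons (a : ℕ) (w : List ℕ) (G : List ℕ → List ℕ → M) :
    decSum (a :: w) G = G [] (a :: w) + decSum w (fun u v => G (a :: u) v) := by
  rw [decSum, List.length_cons, Finset.sum_range_succ']
  simp [decSum, add_comm]

lemma decSum_nil (G : List ℕ → List ℕ → M) : decSum [] G = G [] [] := by
  simp [decSum]

lemma shSum_map (f : ℕ → ℕ) (u v : List ℕ) (F : List ℕ → M) :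
    shSum (u.map f) (v.map f) F = shSum u v (fun w => F (w.map f)) := by
  induction u, v using shuffle.induct generalizing F with
  | case1 v => simp [shSum_nil_left]
  | case2 a u => simp [shSum_nil_right]
  | case3 a u b v ih1 ih2 =>
    simp only [List.map_cons, shSum_cons_cons] at *
    rw [ih1, ih2]

lemma shSum_assoc (u v w : List ℕ) (F : List ℕ → M) :
    shSum u v (fun x => shSum x w F) = shSum v w (fun y => shSum u y F) := by
  match u, v, w with
  | [], v, w => simp [shSum_nil_left]
  | a :: u, [], w => simp [shSum_nil_left, shSum_nil_right]
  | a :: u, b :: v, [] => simp [shSum_nil_right]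
  | a :: u, b :: v, c :: w =>
    have h1 := shSum_assoc u (b :: v) (c :: w) (fun x => F (a :: x))
    have h2 := shSum_assoc (a :: u) v (c :: w) (fun x => F (b :: x))
    have h3 := shSum_assoc (a :: u) (b :: v) w (fun x => F (c :: x))
    simp only [shSum_cons_cons, shSum_add] at h1 h2 h3 ⊢
    rw [← h2, ← h3, h1]
    abel
termination_by u.length + v.length + w.length

lemma shSum_decSum (u v : List ℕ) (G : List ℕ → List ℕ → M) :
    shSum u v (fun w => decSum w G) =
      decSum u fun u₁ u₂ => decSum v fun v₁ v₂ =>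
        shSum u₁ v₁ fun x => shSum u₂ v₂ fun y => G x y := by
  induction u, v using shuffle.induct generalizing G with
  | case1 v => simp [shSum_nil_left, decSum_nil]
  | case2 a u => simp [shSum_nil_right, decSum_nil]
  | case3 a u b v ih1 ih2 =>
    rw [shSum_cons_cons]
    simp only [decSum_cons a, decSum_cons b, shSum_add, shSum_nil_left, shSum_nil_right,
      decSum_add, shSum_cons_cons] at ih1 ih2 ⊢
    rw [ih1, ih2]
    abel

end Sums

/-! ### The Hopf algebra -/

/-- The free `k`-module `𝔖Sym` with basis `𝔖`. -/
def SSym (k : Type*) [CommRing k] : Type _ := PermWord →₀ k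

namespace SSym

variable (k : Type*) [CommRing k]

noncomputable instance instAddCommGroup : AddCommGroup (SSym k) := inferInstanceAs (AddCommGroup (PermWord →₀ k))

noncomputable instance : Module k (SSym k) := inferInstanceAs (Module k (PermWord →₀ k))

/-- The basis of `𝔖Sym` given by the permutations. -/
noncomputable def basis : Module.Basis PermWord k (SSym k) := Module.Basis.ofRepr (.refl _ _)

/-- The shifted shuffle product of two permutations `p` and `q`: the sum of all shuffles of `p`
and `q + m`, where `m` is the length of `p`. -/
noncomputable def mulBasis (p q : PermWord) : SSym k :=
  ((shuffle p.1 (shift p.length q.1)).attach.map fun τ =>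
    basis k ⟨τ.1, isPermWord_of_mem_shuffle p.2 q.2 τ.2⟩).sum

/-- The shifted shuffle product, as a bilinear map. -/
noncomputable def mulMap : SSym k →ₗ[k] SSym k →ₗ[k] SSym k :=
  (basis k).constr k fun p => (basis k).constr k fun q => mulBasis k p q

/-- The coproduct: deconcatenation followed by standardization of the two factors. -/
noncomputable def comulMap : SSym k →ₗ[k] SSym k ⊗[k] SSym k :=
  (basis k).constr k fun p =>
    ∑ i ∈ Finset.range (p.length + 1), basis k (p.stTake i) ⊗ₜ[k] basis k (p.stDrop i)

open scoped Classical in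
/-- The counit: the projection on the coefficient of the empty permutation. -/
noncomputable def counitMap : SSym k →ₗ[k] k :=
  (basis k).constr k fun p => if p = PermWord.empty then 1 else 0

noncomputable instance : Mul (SSym k) := ⟨fun x y => mulMap k x y⟩

noncomputable instance : One (SSym k) := ⟨basis k PermWord.empty⟩

lemma mul_def (x y : SSym k) : x * y = mulMap k x y := rfl

lemma one_def : (1 : SSym k) = basis k PermWord.empty := rfl

lemma basis_mul_basis (p q : PermWord) : basis k p * basis k q = mulBasis k p q := by
  simp [mul_def, mulMap, Module.Basis.constr_basis]

open scoped Classical in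
/-- The basis element of a word, `0` if the word is not a permutation. -/
noncomputable def ofWord (w : List ℕ) : SSym k :=
  if h : IsPermWord w then basis k ⟨w, h⟩ else 0

lemma ofWord_val (p : PermWord) : ofWord k p.1 = basis k p := by
  rw [ofWord, dif_pos p.2]

lemma basis_mul_basis' (p q : PermWord) :
    basis k p * basis k q = shSum p.1 (shift p.length q.1) (ofWord k) := by
  rw [basis_mul_basis, mulBasis, shSum]
  conv_rhs => rw [← Multiset.attach_map_val (shuffle p.1 (shift p.length q.1)), Multiset.map_map]
  congr 1
  refine Multiset.map_congr rfl fun τ _ => ?_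
  exact (ofWord_val k ⟨τ.1, isPermWord_of_mem_shuffle p.2 q.2 τ.2⟩).symm

lemma mul_add' (x y z : SSym k) : x * (y + z) = x * y + x * z := by simp [mul_def]

lemma add_mul' (x y z : SSym k) : (x + y) * z = x * z + y * z := by simp [mul_def]

/-- Sums over shuffles can be pushed through additive maps. -/
lemma map_shSum {M N : Type*} [AddCommMonoid M] [AddCommMonoid N] (f : M →+ N) (u v : List ℕ)
    (F : List ℕ → M) : f (shSum u v F) = shSum u v (fun w => f (F w)) := by
  simp [shSum, map_multiset_sum, Multiset.map_map]

lemma ofWord_mul_basis {w : List ℕ} (hw : IsPermWord w) (r : PermWord) :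
    ofWord k w * basis k r = shSum w (shift w.length r.1) (ofWord k) := by
  have := basis_mul_basis' k ⟨w, hw⟩ r
  rwa [← ofWord_val k ⟨w, hw⟩] at this

lemma basis_mul_ofWord {w : List ℕ} (hw : IsPermWord w) (p : PermWord) :
    basis k p * ofWord k w = shSum p.1 (shift p.length w) (ofWord k) := by
  have := basis_mul_basis' k p ⟨w, hw⟩
  rwa [← ofWord_val k ⟨w, hw⟩] at this

lemma basis_mul_assoc (p q r : PermWord) :
    basis k p * basis k q * basis k r = basis k p * (basis k q * basis k r) := by
  have h1 : basis k p * basis k q * basis k r =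
      shSum p.1 (shift p.length q.1)
        fun x => shSum x (shift (p.length + q.length) r.1) (ofWord k) := by
    rw [basis_mul_basis', mul_def]
    change ((mulMap k).flip (basis k r)).toAddMonoidHom _ = _
    rw [map_shSum]
    refine shSum_congr fun w hw => ?_
    have hw' : IsPermWord w := by
      have h2 := isPermWord_append_shift p.2 q.2
      unfold IsPermWord at *
      rw [hw.length_eq]
      exact hw.trans h2
    change ofWord k w * basis k r = _
    rw [ofWord_mul_basis k hw', hw.length_eq]
    simp [shift, PermWord.length]
  have h2 : basis k p * (basis k q * basis k r) =
      shSum (shift p.length q.1) (shift (p.length + q.length) r.1)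
        fun y => shSum p.1 y (ofWord k) := by
    rw [basis_mul_basis' k q r, mul_def]
    change (mulMap k (basis k p)).toAddMonoidHom _ = _
    rw [map_shSum]
    have : shift (p.length + q.length) r.1 = shift p.length (shift q.length r.1) := by
      simp [shift, Function.comp_def, add_comm, add_left_comm]
    rw [this]
    unfold shift
    rw [shSum_map]
    refine shSum_congr fun w hw => ?_
    have hw' : IsPermWord w := by
      have h2 := isPermWord_append_shift q.2 r.2
      unfold IsPermWord at *
      rw [hw.length_eq]
      exact hw.trans h2
    exact basis_mul_ofWord k hw' p
  rw [h1, h2, shSum_assoc]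

lemma one_mul' (x : SSym k) : 1 * x = x := by
  have : mulMap k (basis k PermWord.empty) = LinearMap.id := by
    refine (basis k).ext fun p => ?_
    have := basis_mul_basis' k PermWord.empty p
    rw [mul_def] at this
    rw [this]
    have h : (PermWord.empty).1 = [] := rfl
    have h' : (PermWord.empty).length = 0 := rfl
    rw [h, h', shSum_nil_left]
    simp [shift, ofWord_val]
  exact LinearMap.congr_fun this x

lemma mul_one' (x : SSym k) : x * 1 = x := by
  have : (mulMap k).flip (basis k PermWord.empty) = LinearMap.id := by
    refine (basis k).ext fun p => ?_
    have := basis_mul_basis' k p PermWord.empty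
    rw [mul_def] at this
    rw [LinearMap.flip_apply, this]
    have h : (PermWord.empty).1 = [] := rfl
    rw [h, shift, List.map_nil, shSum_nil_right]
    simp [ofWord_val]
  exact LinearMap.congr_fun this x

lemma induction_basis {P : SSym k → Prop} (x : SSym k) (hb : ∀ p, P (basis k p))
    (hadd : ∀ x y, P x → P y → P (x + y)) (hsmul : ∀ (c : k) x, P x → P (c • x)) : P x := by
  have hx : x ∈ Submodule.span k (Set.range (basis k)) := by
    rw [(basis k).span_eq]
    trivial
  induction hx using Submodule.span_induction with
  | mem x h => obtain ⟨p, rfl⟩ := h; exact hb p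
  | zero => simpa using hsmul 0 _ (hb PermWord.empty)
  | add x y _ _ hx hy => exact hadd x y hx hy
  | smul c x _ hx => exact hsmul c x hx

lemma smul_mul' (c : k) (x y : SSym k) : c • x * y = c • (x * y) := by simp [mul_def]

lemma mul_smul' (c : k) (x y : SSym k) : x * c • y = c • (x * y) := by simp [mul_def]

lemma mul_assoc' (x y z : SSym k) : x * y * z = x * (y * z) := by
  induction x using induction_basis with
  | hadd x x' h h' => simp only [add_mul', h, h']
  | hsmul c x h => simp only [smul_mul', h]
  | hb p =>
    induction y using induction_basis with
    | hadd x x' h h' => simp only [add_mul', mul_add', h, h']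
    | hsmul c x h => simp only [smul_mul', mul_smul', h]
    | hb q =>
      induction z using induction_basis with
      | hadd x x' h h' => simp only [mul_add', h, h']
      | hsmul c x h => simp only [mul_smul', h]
      | hb r => exact basis_mul_assoc k p q r

noncomputable instance instRing : Ring (SSym k) where
  __ := instAddCommGroup k
  mul := (· * ·)
  one := 1
  left_distrib := mul_add' k
  right_distrib := add_mul' k
  zero_mul x := by simp [mul_def]
  mul_zero x := by simp [mul_def]
  mul_assoc := mul_assoc' k
  one_mul := one_mul' k
  mul_one := mul_one' k

noncomputable instance : Algebra k (SSym k) :=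
  Algebra.ofModule (smul_mul' k) fun c x y => mul_smul' k c x y

lemma comulMap_basis (p : PermWord) : comulMap k (basis k p) =
    ∑ i ∈ Finset.range (p.length + 1), basis k (p.stTake i) ⊗ₜ[k] basis k (p.stDrop i) := by
  simp [comulMap, Module.Basis.constr_basis]

open scoped Classical in
lemma counitMap_basis (p : PermWord) :
    counitMap k (basis k p) = if p = PermWord.empty then 1 else 0 := by
  simp [counitMap, Module.Basis.constr_basis]

lemma counitMap_basis_of_pos (p : PermWord) (h : 0 < p.length) : counitMap k (basis k p) = 0 := by
  rw [counitMap_basis, if_neg]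
  rintro rfl
  exact absurd h (by simp [PermWord.length, PermWord.empty])

lemma counitMap_empty : counitMap k (basis k PermWord.empty) = 1 := by
  simp [counitMap_basis]

noncomputable instance : Coalgebra k (SSym k) where
  comul := comulMap k
  counit := counitMap k
  coassoc := by
    refine (basis k).ext fun p => ?_
    simp only [LinearMap.comp_apply, comulMap_basis, map_sum, LinearMap.rTensor_tmul,
      LinearMap.lTensor_tmul, TensorProduct.sum_tmul, TensorProduct.tmul_sum,
      LinearEquiv.coe_coe, TensorProduct.assoc_tmul, PermWord.length_stTake,
      PermWord.length_stDrop]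
    rw [Finset.sum_sigma', Finset.sum_sigma']
    refine Finset.sum_bij' (fun x _ => ⟨x.2, x.1 - x.2⟩) (fun x _ => ⟨x.1 + x.2, x.1⟩) ?_ ?_ ?_ ?_ ?_
    · rintro ⟨i, j⟩ h
      simp at h ⊢
      omega
    · rintro ⟨i, j⟩ h
      simp at h ⊢
      omega
    · rintro ⟨i, j⟩ h
      simp at h ⊢
      omega
    · rintro ⟨i, j⟩ h
      simp at h ⊢
    · rintro ⟨i, j⟩ h
      simp at h ⊢
      obtain ⟨m, rfl⟩ : ∃ m, i = j + m := ⟨i - j, by omega⟩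
      rw [PermWord.stTake_stTake _ _ _ (by omega), PermWord.stDrop_stTake, PermWord.stDrop_stDrop]
      simp
  rTensor_counit_comp_comul := by
    refine (basis k).ext fun p => ?_
    simp only [LinearMap.comp_apply, comulMap_basis, map_sum, LinearMap.rTensor_tmul]
    rw [Finset.sum_eq_single 0]
    · simp [PermWord.stTake_zero, PermWord.stDrop_zero, counitMap_empty]
    · intro i hi h0
      rw [counitMap_basis_of_pos, TensorProduct.zero_tmul]
      rw [PermWord.length_stTake]
      simp at hi
      omega
    · simp
  lTensor_counit_comp_comul := by
    refine (basis k).ext fun p => ?_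
    simp only [LinearMap.comp_apply, comulMap_basis, map_sum, LinearMap.lTensor_tmul]
    rw [Finset.sum_eq_single p.length]
    · simp [PermWord.stTake_length, PermWord.stDrop_length, counitMap_empty]
    · intro i hi h0
      rw [counitMap_basis_of_pos, TensorProduct.tmul_zero]
      rw [PermWord.length_stDrop]
      simp at hi
      omega
    · simp

lemma comul_basis (p : PermWord) : Coalgebra.comul (R := k) (basis k p) =
    ∑ i ∈ Finset.range (p.length + 1), basis k (p.stTake i) ⊗ₜ[k] basis k (p.stDrop i) :=
  comulMap_basis k p

lemma comul_basis' (p : PermWord) : Coalgebra.comul (R := k) (basis k p) =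
    decSum p.1 fun u v => ofWord k (standardize u) ⊗ₜ[k] ofWord k (standardize v) := by
  rw [comul_basis, decSum]
  refine Finset.sum_congr rfl fun i _ => ?_
  rw [← ofWord_val, ← ofWord_val]
  rfl

/-- Standardization is compatible with shuffles of two words, the letters of the first of which
are smaller than those of the second. -/
lemma shSum_standardize (u v : List ℕ) (hu : u.Nodup) (hv : v.Nodup)
    (h : ∀ x ∈ u, ∀ y ∈ v, x < y) :
    shSum u v (fun w => ofWord k (standardize w)) =
      ofWord k (standardize u) * ofWord k (standardize v) := by
  have hsu := isPermWord_standardize hu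
  have hsv := isPermWord_standardize hv
  have h1 := basis_mul_basis' k ⟨_, hsu⟩ ⟨_, hsv⟩
  rw [← ofWord_val, ← ofWord_val] at h1
  rw [h1]
  have e1 : standardize u = u.map fun x => (u ++ v).countP (· ≤ x) := by
    refine List.map_congr_left fun x hx => ?_
    have : v.countP (· ≤ x) = 0 := List.countP_eq_zero.2 fun y hy => by
      simpa using h x hx y hy
    rw [List.countP_append, this, add_zero]
  have e2 : shift (PermWord.length ⟨_, hsu⟩) (standardize v) =
      v.map fun x => (u ++ v).countP (· ≤ x) := by
    rw [shift, standardize.eq_def v, List.map_map]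
    refine List.map_congr_left fun x hx => ?_
    have : u.countP (· ≤ x) = u.length := List.countP_eq_length.2 fun y hy => by
      simpa using (h y hy x hx).le
    rw [List.countP_append, this]
    simp [PermWord.length, standardize, add_comm]
  rw [e2]
  change _ = shSum (standardize u) _ _
  rw [e1, shSum_map]
  refine shSum_congr fun w hw => ?_
  congr 1
  exact List.map_congr_left fun x _ => hw.countP_eq _

lemma decSum_tmul_mul (u v : List ℕ) (F G F' G' : List ℕ → SSym k) :
    decSum u (fun u₁ u₂ => F u₁ ⊗ₜ[k] G u₂) * decSum v (fun v₁ v₂ => F' v₁ ⊗ₜ[k] G' v₂) =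
      decSum u fun u₁ u₂ => decSum v fun v₁ v₂ => (F u₁ * F' v₁) ⊗ₜ[k] (G u₂ * G' v₂) := by
  simp only [decSum, Finset.sum_mul_sum, Algebra.TensorProduct.tmul_mul_tmul]

lemma comul_mul_basis (p q : PermWord) : Coalgebra.comul (R := k) (basis k p * basis k q) =
    Coalgebra.comul (R := k) (basis k p) * Coalgebra.comul (R := k) (basis k q) := by
  rw [basis_mul_basis']
  change (Coalgebra.comul (R := k) (A := SSym k)).toAddMonoidHom _ = _
  rw [map_shSum]
  have h1 : shSum p.1 (shift p.length q.1)
      (fun w => (Coalgebra.comul (R := k) (A := SSym k)).toAddMonoidHom (ofWord k w)) =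
      shSum p.1 (shift p.length q.1) (fun w => decSum w fun u v =>
        ofWord k (standardize u) ⊗ₜ[k] ofWord k (standardize v)) := by
    refine shSum_congr fun w hw => ?_
    have hw' : IsPermWord w := by
      have h2 := isPermWord_append_shift p.2 q.2
      unfold IsPermWord at *
      rw [hw.length_eq]
      exact hw.trans h2
    have := comul_basis' k ⟨w, hw'⟩
    rwa [← ofWord_val] at this
  rw [h1, shSum_decSum, comul_basis', comul_basis', decSum_tmul_mul]
  unfold decSum
  refine Finset.sum_congr rfl fun i _ => ?_
  have hl : (shift p.length q.1).length = q.1.length := by simp [shift]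
  rw [hl]
  refine Finset.sum_congr rfl fun j _ => ?_
  have hlt : ∀ x ∈ p.1, ∀ y ∈ shift p.length q.1, x < y := by
    intro x hx y hy
    obtain ⟨z, hz, rfl⟩ := List.mem_map.1 hy
    have := p.2.le hx
    have := q.2.pos hz
    simp only [PermWord.length]
    omega
  have hnd : (shift p.length q.1).Nodup := q.2.nodup.map (add_left_injective _)
  have hst : ∀ w, standardize (shift p.length w) = standardize w := fun w =>
    standardize_map _ _ fun x _ y _ => by simp
  beta_reduce
  rw [← hst (q.1.take j), ← hst (q.1.drop j)]
  have ht : shift p.length (q.1.take j) = (shift p.length q.1).take j := List.map_take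
  have hd : shift p.length (q.1.drop j) = (shift p.length q.1).drop j := List.map_drop
  rw [ht, hd, ← shSum_standardize k _ _ (p.2.nodup.sublist (List.take_sublist _ _))
      (hnd.sublist (List.take_sublist _ _))
      (fun x hx y hy => hlt x (List.mem_of_mem_take hx) y (List.mem_of_mem_take hy)),
    ← shSum_standardize k _ _ (p.2.nodup.sublist (List.drop_sublist _ _))
      (hnd.sublist (List.drop_sublist _ _))
      (fun x hx y hy => hlt x (List.mem_of_mem_drop hx) y (List.mem_of_mem_drop hy))]
  have e1 : ∀ (u v : List ℕ) (F : List ℕ → SSym k) (z : SSym k),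
      (shSum u v F) ⊗ₜ[k] z = shSum u v (fun w => F w ⊗ₜ[k] z) := fun u v F z =>
    map_shSum ((TensorProduct.mk k (SSym k) (SSym k)).flip z).toAddMonoidHom u v F
  have e2 : ∀ (u v : List ℕ) (F : List ℕ → SSym k) (z : SSym k),
      z ⊗ₜ[k] (shSum u v F) = shSum u v (fun w => z ⊗ₜ[k] F w) := fun u v F z =>
    map_shSum (TensorProduct.mk k (SSym k) (SSym k) z).toAddMonoidHom u v F
  rw [e1]
  simp only [e2]

lemma counit_mul_basis (p q : PermWord) : counitMap k (basis k p * basis k q) =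
    counitMap k (basis k p) * counitMap k (basis k q) := by
  rcases Nat.eq_zero_or_pos p.length with hp | hp
  · rw [PermWord.eq_empty hp, ← one_def, one_mul, one_def, counitMap_empty, one_mul]
  · rw [counitMap_basis_of_pos k p hp, zero_mul, basis_mul_basis, mulBasis, map_multiset_sum,
      Multiset.map_map]
    refine Multiset.sum_eq_zero fun x hx => ?_
    obtain ⟨τ, _, rfl⟩ := Multiset.mem_map.1 hx
    refine counitMap_basis_of_pos k _ ?_
    have := (perm_append_of_mem_shuffle _ _ _ τ.2).length_eq
    simp only [PermWord.length, List.length_append] at *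
    omega

noncomputable instance : Bialgebra k (SSym k) := Bialgebra.mk' k (SSym k)
  (counit_one := counitMap_empty k)
  (counit_mul := by
    intro x y
    change counitMap k (x * y) = counitMap k x * counitMap k y
    induction x using induction_basis with
    | hadd x x' h h' => simp only [add_mul, map_add, h, h']
    | hsmul c x h => simp only [smul_mul_assoc, map_smul, h]
    | hb p =>
      induction y using induction_basis with
      | hadd x x' h h' => simp only [mul_add, map_add, h, h']
      | hsmul c x h => simp only [mul_smul_comm, map_smul, h]
      | hb q => exact counit_mul_basis k p q)
  (comul_one := by
    have h0 : (PermWord.empty).length = 0 := rfl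
    rw [one_def, comul_basis, h0]
    simp [PermWord.stTake_zero, PermWord.stDrop_zero, Algebra.TensorProduct.one_def, one_def])
  (comul_mul := by
    intro x y
    induction x using induction_basis with
    | hadd x x' h h' => simp only [add_mul, map_add, h, h']
    | hsmul c x h => simp only [smul_mul_assoc, map_smul, h]
    | hb p =>
      induction y using induction_basis with
      | hadd x x' h h' => simp only [mul_add, map_add, h, h']
      | hsmul c x h => simp only [mul_smul_comm, map_smul, h]
      | hb q => exact comul_mul_basis k p q)

/-- The recursion `S(∅) = ∅`, `S(σ) = - ∑_{i < n} S(st(σ₁ ⋯ σᵢ)) · st(σᵢ₊₁ ⋯ σₙ)` for the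
antipode. -/
noncomputable def antipodeBasis (p : PermWord) : SSym k :=
  if p.length = 0 then basis k PermWord.empty else
    -∑ i : Fin p.length, antipodeBasis (p.stTake i) * basis k (p.stDrop i)
termination_by p.length
decreasing_by
  rw [PermWord.length_stTake]
  omega

/-- The mirror recursion, used to see that the antipode is two-sided. -/
noncomputable def antipodeBasis' (p : PermWord) : SSym k :=
  if p.length = 0 then basis k PermWord.empty else
    -∑ i : Fin p.length, basis k (p.stTake (i + 1)) * antipodeBasis' (p.stDrop (i + 1))
termination_by p.length
decreasing_by
  rw [PermWord.length_stDrop]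
  omega

/-- The antipode of `𝔖Sym`, as a linear map. -/
noncomputable def antipodeMap : SSym k →ₗ[k] SSym k := (basis k).constr k (antipodeBasis k)

/-- The right convolution inverse of the identity. -/
noncomputable def antipodeMap' : SSym k →ₗ[k] SSym k := (basis k).constr k (antipodeBasis' k)

lemma sum_antipodeBasis_mul (p : PermWord) :
    ∑ i ∈ Finset.range (p.length + 1), antipodeBasis k (p.stTake i) * basis k (p.stDrop i) =
      algebraMap k (SSym k) (counitMap k (basis k p)) := by
  rcases Nat.eq_zero_or_pos p.length with hp | hp
  · have h0 : (PermWord.empty).length = 0 := rfl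
    rw [PermWord.eq_empty hp, counitMap_empty, map_one, h0]
    simp [PermWord.stTake_zero, PermWord.stDrop_zero]
    rw [antipodeBasis, if_pos h0, ← one_def, one_mul]
  · rw [counitMap_basis_of_pos k p hp, map_zero, Finset.sum_range_succ, PermWord.stTake_length,
      PermWord.stDrop_length, ← one_def, mul_one, antipodeBasis, if_neg hp.ne', Fin.sum_univ_eq_sum_range
        (fun i => antipodeBasis k (p.stTake i) * basis k (p.stDrop i))]
    simp

lemma sum_mul_antipodeBasis' (p : PermWord) :
    ∑ i ∈ Finset.range (p.length + 1), basis k (p.stTake i) * antipodeBasis' k (p.stDrop i) =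
      algebraMap k (SSym k) (counitMap k (basis k p)) := by
  rcases Nat.eq_zero_or_pos p.length with hp | hp
  · have h0 : (PermWord.empty).length = 0 := rfl
    rw [PermWord.eq_empty hp, counitMap_empty, map_one, h0]
    simp [PermWord.stTake_zero, PermWord.stDrop_zero]
    rw [antipodeBasis', if_pos h0, ← one_def, one_mul]
  · rw [counitMap_basis_of_pos k p hp, map_zero, Finset.sum_range_succ', PermWord.stTake_zero,
      PermWord.stDrop_zero, ← one_def, one_mul, antipodeBasis', if_neg hp.ne', Fin.sum_univ_eq_sum_range
        (fun i => basis k (p.stTake (i + 1)) * antipodeBasis' k (p.stDrop (i + 1)))]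
    simp

lemma antipodeMap_comul : LinearMap.mul' k (SSym k) ∘ₗ (antipodeMap k).rTensor (SSym k) ∘ₗ
    Coalgebra.comul = Algebra.linearMap k (SSym k) ∘ₗ Coalgebra.counit := by
  refine (basis k).ext fun p => ?_
  simp only [LinearMap.comp_apply, comul_basis, map_sum, LinearMap.rTensor_tmul,
    LinearMap.mul'_apply, antipodeMap, Module.Basis.constr_basis]
  exact sum_antipodeBasis_mul k p

lemma antipodeMap'_comul : LinearMap.mul' k (SSym k) ∘ₗ (antipodeMap' k).lTensor (SSym k) ∘ₗ
    Coalgebra.comul = Algebra.linearMap k (SSym k) ∘ₗ Coalgebra.counit := by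
  refine (basis k).ext fun p => ?_
  simp only [LinearMap.comp_apply, comul_basis, map_sum, LinearMap.lTensor_tmul,
    LinearMap.mul'_apply, antipodeMap', Module.Basis.constr_basis]
  exact sum_mul_antipodeBasis' k p

lemma antipodeMap_eq : antipodeMap k = antipodeMap' k := by
  have h1 : WithConv.toConv (antipodeMap k) * WithConv.toConv LinearMap.id = 1 := by
    refine WithConv.ofConv_injective ?_
    rw [LinearMap.convMul_def, LinearMap.convOne_def]
    exact antipodeMap_comul k
  have h2 : WithConv.toConv LinearMap.id * WithConv.toConv (antipodeMap' k) = 1 := by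
    refine WithConv.ofConv_injective ?_
    rw [LinearMap.convMul_def, LinearMap.convOne_def]
    exact antipodeMap'_comul k
  exact WithConv.toConv_injective (left_inv_eq_right_inv h1 h2)

/-- The Malvenuto–Reutenauer Hopf algebra of permutations. -/
noncomputable instance : HopfAlgebra k (SSym k) where
  antipode := antipodeMap k
  mul_antipode_rTensor_comul := antipodeMap_comul k
  mul_antipode_lTensor_comul := by
    rw [antipodeMap_eq]
    exact antipodeMap'_comul k

/-- The inclusion of `𝔖Sym` into the free module on all words, sending a permutation to its
one-line notation. -/
noncomputable def toWords : SSym k →ₗ[k] (List ℕ →₀ k) :=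
  (basis k).constr k fun p => Finsupp.single p.word 1

lemma toWords_injective : Function.Injective (toWords k) := by
  have h : ∀ x, toWords k x = Finsupp.mapDomain PermWord.word ((basis k).repr x) := by
    intro x
    rw [toWords, Module.Basis.constr_apply]
    simp [Finsupp.mapDomain]
  have hw : Function.Injective PermWord.word := fun p q hpq => PermWord.ext hpq
  intro x y hxy
  rw [h, h] at hxy
  exact (basis k).repr.injective (Finsupp.mapDomain_injective hw hxy)

end SSym

/-! ### The permutations `σ_A` -/

/-- The word `δ_A η_{Ā}`: the elements of `A` in decreasing order, followed by those of
`{1, …, n} \ A` in increasing order. -/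
def sigmaWord (n : ℕ) (A : Finset ℕ) : List ℕ :=
  A.sort (· ≥ ·) ++ (Finset.Icc 1 n \ A).sort (· ≤ ·)

lemma isPermWord_sigmaWord {n : ℕ} {A : Finset ℕ} (hA : A ⊆ Finset.Icc 1 n) :
    IsPermWord (sigmaWord n A) := by
  have hlen : (sigmaWord n A).length = n := by
    have := Finset.card_le_card hA
    simp [sigmaWord, Finset.card_sdiff_of_subset hA] at this ⊢
    omega
  rw [isPermWord_iff, hlen]
  constructor
  · rw [sigmaWord, List.nodup_append]
    refine ⟨Finset.sort_nodup _ _, Finset.sort_nodup _ _, fun x hx y hy => ?_⟩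
    simp at hx hy
    rintro rfl
    exact hy.2 hx
  · intro x hx
    simp [sigmaWord] at hx
    rcases hx with hx | hx
    · simpa using hA hx
    · exact hx.1

/-- The permutation `σ_{A,n} = δ_A η_{Ā}` for `A ⊆ {1, …, n}`. -/
def sigma (n : ℕ) (A : Finset ℕ) (hA : A ⊆ Finset.Icc 1 n) : PermWord :=
  ⟨sigmaWord n A, isPermWord_sigmaWord hA⟩

lemma singleton_subset_Icc {a n : ℕ} (h1 : 1 < a) (h2 : a ≤ n) : {a} ⊆ Finset.Icc 1 n := by
  simp
  omega

lemma pair_subset_Icc {a b n : ℕ} (h0 : 1 ≤ b) (h1 : b < a) (h2 : a ≤ n) :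
    {a, b} ⊆ Finset.Icc 1 n := by
  simp [Finset.insert_subset_iff]
  omega

/-! ### Formal sums of words -/

/-- Finite formal sums of words with nonnegative integer coefficients (the coefficient of a word
is its multiplicity). -/
abbrev WordSum : Type := Multiset (List ℕ)

namespace WordSum

/-- A single word. -/
def word (w : List ℕ) : WordSum := {w}

/-- `η_{k,l}`: the word `k (k+1) ⋯ l` if `k ≤ l`, the empty word if `k = l + 1`, and `0` if
`k ≥ l + 2`. -/
def eta (k l : ℕ) : WordSum :=
  if k ≤ l then {List.range' k (l + 1 - k)} else if k = l + 1 then {[]} else 0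

/-- `δ_{l,k}`: the word `l (l-1) ⋯ k` if `k ≤ l`, the empty word if `k = l + 1`, and `0` if
`k ≥ l + 2`. -/
def delta (l k : ℕ) : WordSum :=
  if k ≤ l then {(List.range' k (l + 1 - k)).reverse} else if k = l + 1 then {[]} else 0

/-- Concatenation, extended bilinearly. -/
def concat (M N : WordSum) : WordSum := M.bind fun u => N.map fun v => u ++ v

/-- The shuffle product, extended bilinearly. -/
def sh (M N : WordSum) : WordSum := M.bind fun u => N.bind fun v => shuffle u v

end WordSum

infixl:75 " ⬝ " => MalvenutoReutenauer.WordSum.concat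

infixl:70 " ⧢ " => MalvenutoReutenauer.WordSum.sh

/-- Formal sums of signed words `± w`, in which opposite terms are not cancelled. -/
abbrev SignedSum : Type := Multiset (ℤˣ × List ℕ)

namespace SignedSum

/-- The signed sum `ε M`. -/
def signed (ε : ℤˣ) (M : WordSum) : SignedSum := M.map fun w => (ε, w)

/-- The value of a signed sum in the free `k`-module on all words. -/
noncomputable def eval (k : Type*) [CommRing k] (E : SignedSum) : List ℕ →₀ k :=
  (E.map fun t => Finsupp.single t.2 (((t.1 : ℤ) : k))).sum

/-- No word occurs in `E` with both signs. -/
def CancellationFree (E : SignedSum) : Prop := ∀ w, ¬ ((1, w) ∈ E ∧ (-1, w) ∈ E)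

end SignedSum

/-- `x` equals the value of the signed sum `E` (compared as combinations of words), and `E` is
cancellation-free. -/
def IsCancellationFreeFormula {k : Type*} [CommRing k] (x : SSym k) (E : SignedSum) : Prop :=
  SSym.toWords k x = E.eval k ∧ E.CancellationFree

end MalvenutoReutenauer

open MalvenutoReutenauer MalvenutoReutenauer.WordSum MalvenutoReutenauer.SignedSum

/-!
The antipode `S` is a right convolution inverse of the identity, so
`S(w) = -∑_{i ≥ 1} st(w₁ ⋯ wᵢ) · S(st(wᵢ₊₁ ⋯ wₙ))` for a permutation `w` of `1, …, n`
(`antipodeWords_eq_neg_sum`). By induction it maps the increasing word `1 ⋯ m` to `(-1)^m` times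
the decreasing one (`antipodeWords_range'`), so every term of the recursion with an increasing
suffix is explicit: it is `± st(w₁ ⋯ wᵢ) ⧢ δ_{n,i+1}`. For `w = σ_{a}` all suffixes are
increasing. For `w = σ_{a,2}` the only exception is `i = 1`, where the standardized suffix is
`2 1 3 ⋯ (n-1)`, which is `σ_{2}`; its antipode is known from the first case.

It remains to simplify an alternating sum of shuffles of words with decreasing words. Splitting
each shuffle by its last letter (`concat_sh_delta`) writes it as `Yᵢ + Zᵢ`, where the words of `Yᵢ`
end in the last letter of the prefix and those of `Zᵢ` in `i + 1`. For `i > a` the prefix ends in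
its maximum `i`, so `Yᵢ = Zᵢ₋₁` and the sum telescopes to `Y_a` (`sum_sh_delta_telescope`). For
`i ≤ a` nothing cancels but a few shuffles with very short prefixes, and regrouping the rest by
last letters (`sum_alternating_regroup`, `sum_alternating_shift`) gives the formulas.

They are cancellation-free because the sign of a term is a function of its word
(`cancellationFree_of_sign`): the last letter determines it, except that in the second formula the
words ending in `3` are also separated by the order in which `1` and `2` occur.
-/

namespace MalvenutoReutenauer

/-! ### Shuffles of words by their last letters -/

lemma shuffle_concat_concat (u v : List ℕ) (x y : ℕ) :
    shuffle (u ++ [x]) (v ++ [y]) =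
      (shuffle u (v ++ [y])).map (· ++ [x]) + (shuffle (u ++ [x]) v).map (· ++ [y]) := by
  match u, v with
  | [], [] => simp [shuffle, add_comm]
  | [], b :: v =>
    have h := shuffle_concat_concat [] v x y
    simp only [List.nil_append, List.cons_append, shuffle, Multiset.map_singleton,
      Multiset.map_add, Multiset.map_map] at h ⊢
    rw [h]
    simp only [Multiset.map_add, Multiset.map_map, Multiset.map_singleton, Function.comp_def,
      List.cons_append, List.append_assoc]
    abel
  | a :: u, [] =>
    have h := shuffle_concat_concat u [] x y
    simp only [List.nil_append, List.cons_append, shuffle, shuffle_nil_right,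
      Multiset.map_singleton, Multiset.map_add, Multiset.map_map] at h ⊢
    rw [h]
    simp only [Multiset.map_add, Multiset.map_map, Multiset.map_singleton, Function.comp_def,
      List.cons_append, List.append_assoc]
    abel
  | a :: u, b :: v =>
    have h₁ := shuffle_concat_concat u (b :: v) x y
    have h₂ := shuffle_concat_concat (a :: u) v x y
    simp only [List.cons_append, shuffle, Multiset.map_add, Multiset.map_map] at h₁ h₂ ⊢
    rw [h₁, h₂]
    simp only [Multiset.map_add, Multiset.map_map, Function.comp_def, List.cons_append]
    abel
termination_by u.length + v.length

lemma filter_of_mem_shuffle {u v w : List ℕ} (h : w ∈ shuffle u v) {p : ℕ → Bool}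
    (hv : ∀ x ∈ v, p x = false) : w.filter p = u.filter p := by
  induction u, v using shuffle.induct generalizing w with
  | case1 v =>
    obtain rfl : w = v := by simpa [shuffle] using h
    simpa using hv
  | case2 a u =>
    obtain rfl : w = a :: u := by simpa [shuffle] using h
    rfl
  | case3 a u b v ih₁ ih₂ =>
    rw [shuffle, Multiset.mem_add, Multiset.mem_map, Multiset.mem_map] at h
    rcases h with ⟨x, hx, rfl⟩ | ⟨x, hx, rfl⟩
    · rw [List.filter_cons, List.filter_cons, ih₁ hx hv]
    · rw [List.filter_cons, hv b (by simp), ih₂ hx fun y hy => hv y (by simp [hy])]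
      simp

/-! ### Calculus of formal sums of words -/

namespace WordSum

lemma mem_sh {M N : WordSum} {w : List ℕ} :
    w ∈ M ⧢ N ↔ ∃ u ∈ M, ∃ v ∈ N, w ∈ shuffle u v := by
  simp [sh]

lemma word_concat_word (u v : List ℕ) : word u ⬝ word v = word (u ++ v) := by
  simp [word, concat]

lemma concat_word (M : WordSum) (v : List ℕ) : M ⬝ word v = M.map (· ++ v) := by
  simp [word, concat, Multiset.bind_singleton]

lemma add_concat (M N P : WordSum) : (M + N) ⬝ P = M ⬝ P + N ⬝ P := by
  simp [concat]

lemma zero_concat (P : WordSum) : 0 ⬝ P = 0 := by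
  simp [concat]

lemma concat_assoc (M N P : WordSum) : M ⬝ N ⬝ P = M ⬝ (N ⬝ P) := by
  simp [concat, Multiset.bind_assoc, Multiset.map_bind, Multiset.bind_map]

lemma sh_add (M N P : WordSum) : M ⧢ (N + P) = M ⧢ N + M ⧢ P := by
  simp [sh]

lemma add_sh (M N P : WordSum) : (M + N) ⧢ P = M ⧢ P + N ⧢ P := by
  simp [sh]

lemma sh_zero (M : WordSum) : M ⧢ 0 = 0 := by
  simp [sh]

lemma word_sh_word (u v : List ℕ) : word u ⧢ word v = shuffle u v := by
  simp [word, sh]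

lemma word_nil_sh (M : WordSum) : word [] ⧢ M = M := by
  simpa [word, sh, shuffle] using Multiset.bind_singleton M id

lemma sh_word_nil (M : WordSum) : M ⧢ word [] = M := by
  simpa [word, sh, shuffle_nil_right] using Multiset.bind_singleton M id

lemma concat_sh_concat (M N : WordSum) (x y : ℕ) :
    M ⬝ word [x] ⧢ N ⬝ word [y] =
      (M ⧢ N ⬝ word [y]) ⬝ word [x] + (M ⬝ word [x] ⧢ N) ⬝ word [y] := by
  simp only [concat_word, sh, Multiset.bind_map, Multiset.map_bind, shuffle_concat_concat,
    Multiset.bind_add]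

lemma delta_self (n : ℕ) : delta n (n + 1) = word [] := by
  simp [delta, word]

lemma delta_eq_zero {n m : ℕ} (h : n + 2 ≤ m) : delta n m = 0 := by
  rw [delta, if_neg (by omega), if_neg (by omega)]

lemma delta_eq_word {n m : ℕ} (h : m ≤ n + 1) :
    delta n m = word (List.range' m (n + 1 - m)).reverse := by
  rcases Nat.lt_or_ge n m with h' | h'
  · obtain rfl : m = n + 1 := by omega
    simp [delta_self]
  · rw [delta, if_pos h', word]

lemma eta_eq_word {n m : ℕ} (h : m ≤ n + 1) : eta m n = word (List.range' m (n + 1 - m)) := by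
  rcases Nat.lt_or_ge n m with h' | h'
  · obtain rfl : m = n + 1 := by omega
    simp [eta, word]
  · rw [eta, if_pos h', word]

lemma delta_eq_concat {n m : ℕ} (h : m ≤ n) : delta n m = delta n (m + 1) ⬝ word [m] := by
  rw [delta_eq_word (by omega), delta_eq_word (by omega), word_concat_word,
    show n + 1 - m = n + 1 - (m + 1) + 1 by omega, List.range'_succ, List.reverse_cons]

/-- The last letter of a shuffle with `δ_{n,m}` comes from either factor. The convention
`δ_{n,n+2} = 0` makes this hold for the empty word `δ_{n,n+1}` too. -/
lemma concat_sh_delta (M : WordSum) (x : ℕ) {n m : ℕ} (h : m ≤ n + 1) :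
    M ⬝ word [x] ⧢ delta n m =
      (M ⧢ delta n m) ⬝ word [x] + (M ⬝ word [x] ⧢ delta n (m + 1)) ⬝ word [m] := by
  rcases Nat.lt_or_ge n m with h' | h'
  · obtain rfl : m = n + 1 := by omega
    rw [delta_self, delta_eq_zero le_rfl, sh_word_nil, sh_word_nil, sh_zero, zero_concat, add_zero]
  · rw [delta_eq_concat h', concat_sh_concat]

lemma word_concat_sh_delta (u : List ℕ) (x : ℕ) {n m : ℕ} (h : m ≤ n + 1) :
    word (u ++ [x]) ⧢ delta n m =
      (word u ⧢ delta n m) ⬝ word [x] + (word (u ++ [x]) ⧢ delta n (m + 1)) ⬝ word [m] := by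
  rw [← word_concat_word, concat_sh_delta _ _ h]

lemma lt_of_mem_delta {n m : ℕ} {v : List ℕ} (hv : v ∈ delta n m) {x : ℕ} (hx : x ∈ v) :
    m ≤ x := by
  unfold delta at hv
  split_ifs at hv
  · obtain rfl := Multiset.mem_singleton.1 hv
    simp at hx
    omega
  · obtain rfl := Multiset.mem_singleton.1 hv
    simp at hx
  · simp at hv

lemma filter_of_mem_sh_delta {u w : List ℕ} {n m l : ℕ} (h : w ∈ word u ⧢ delta n (m + 1))
    (hl : l ≤ m) : w.filter (· ≤ l) = u.filter (· ≤ l) := by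
  obtain ⟨u', hu, v, hv, hw⟩ := mem_sh.1 h
  obtain rfl := Multiset.mem_singleton.1 hu
  refine filter_of_mem_shuffle hw fun x hx => ?_
  have := lt_of_mem_delta hv hx
  simp
  omega

lemma getLast?_of_mem_concat {M : WordSum} {w v : List ℕ} {x : ℕ}
    (h : w ∈ M ⬝ word (v ++ [x])) : w.getLast? = some x := by
  rw [concat_word, Multiset.mem_map] at h
  obtain ⟨u, _, rfl⟩ := h
  simp [← List.append_assoc]

/-- The value of a formal sum of words in the free `k`-module on all words. -/
noncomputable def toFinsupp (k : Type*) [CommRing k] : WordSum →+ (List ℕ →₀ k) :=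
  Multiset.sumAddMonoidHom.comp (Multiset.mapAddMonoidHom fun w => Finsupp.single w 1)

lemma toFinsupp_apply (k : Type*) [CommRing k] (M : WordSum) :
    toFinsupp k M = (M.map fun w => Finsupp.single w 1).sum := rfl

lemma toFinsupp_word (k : Type*) [CommRing k] (w : List ℕ) :
    toFinsupp k (word w) = Finsupp.single w 1 := by
  simp [toFinsupp_apply, word]

/-- When an increasing run `a+1, …, a+i` is appended to a word one letter at a time, the
alternating sum of the shuffles with the complementary decreasing words telescopes. -/
lemma sum_sh_delta_telescope (k : Type*) [CommRing k] (d a : ℕ) (u : List ℕ) (x : ℕ) :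
    ∑ i ∈ Finset.range (d + 1), (-1 : k) ^ i •
      toFinsupp k (word (u ++ [x] ++ List.range' (a + 1) i) ⧢ delta (a + d) (a + i + 1)) =
      toFinsupp k ((word u ⧢ delta (a + d) (a + 1)) ⬝ word [x]) := by
  induction d generalizing a u x with
  | zero =>
    simp [delta_self, sh_word_nil, word_concat_word]
  | succ d ih =>
    have h := ih (a + 1) (u ++ [x]) (a + 1)
    rw [show a + 1 + d = a + (d + 1) by omega] at h
    rw [Finset.sum_range_succ']
    have hs : ∀ i ∈ Finset.range (d + 1), (-1 : k) ^ (i + 1) •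
        toFinsupp k (word (u ++ [x] ++ List.range' (a + 1) (i + 1)) ⧢
          delta (a + (d + 1)) (a + (i + 1) + 1)) =
        -((-1 : k) ^ i • toFinsupp k (word (u ++ [x] ++ [a + 1] ++ List.range' (a + 1 + 1) i) ⧢
          delta (a + (d + 1)) (a + 1 + i + 1))) := by
      intro i _
      rw [List.range'_succ, pow_succ, mul_neg_one, neg_smul, show a + (i + 1) = a + 1 + i by omega]
      simp
    rw [Finset.sum_congr rfl hs, Finset.sum_neg_distrib, h, List.range'_zero, List.append_nil,
      add_zero, word_concat_sh_delta u x (m := a + 1) (by omega), map_add]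
    simp

end WordSum

namespace SignedSum

lemma mem_signed {ε : ℤˣ} {M : WordSum} {t : ℤˣ × List ℕ} :
    t ∈ signed ε M ↔ t.1 = ε ∧ t.2 ∈ M := by
  obtain ⟨e, w⟩ := t
  simp [signed, and_comm, eq_comm]

/-- A signed sum in which the sign is a function of the word is cancellation-free. -/
lemma cancellationFree_of_sign {E : SignedSum} (sgn : List ℕ → ℤˣ)
    (h : ∀ t ∈ E, t.1 = sgn t.2) : E.CancellationFree := by
  rintro w ⟨h₁, h₂⟩
  have h' : (1 : ℤˣ) = -1 := (h _ h₁).trans (h _ h₂).symm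
  exact absurd h' (by decide)

lemma eval_add (k : Type*) [CommRing k] (E F : SignedSum) :
    (E + F).eval k = E.eval k + F.eval k := by
  simp [eval]

lemma eval_sum (k : Type*) [CommRing k] {ι : Type*} (s : Finset ι) (E : ι → SignedSum) :
    (∑ i ∈ s, E i).eval k = ∑ i ∈ s, (E i).eval k :=
  map_sum (AddMonoidHom.mk' (eval k) (eval_add k)) E s

lemma eval_signed (k : Type*) [CommRing k] (ε : ℤˣ) (M : WordSum) :
    (signed ε M).eval k = ((ε : ℤ) : k) • toFinsupp k M := by
  rw [eval, signed, Multiset.map_map, toFinsupp_apply, Multiset.smul_sum, Multiset.map_map]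
  simp

end SignedSum

/-! ### Shifts of formal sums of words -/

lemma shuffle_map (f : ℕ → ℕ) (u v : List ℕ) :
    shuffle (u.map f) (v.map f) = (shuffle u v).map (List.map f) := by
  have h := shSum_map f u v fun w => ({w} : Multiset (List ℕ))
  have h' : ∀ s : Multiset (List ℕ), (s.map fun w => ({w.map f} : Multiset (List ℕ))).sum =
      s.map (List.map f) := fun s => by
    rw [← Multiset.sum_map_singleton (s.map (List.map f)), Multiset.map_map]
    rfl
  simpa only [shSum, Multiset.sum_map_singleton, h'] using h

namespace WordSum

lemma map_shift_word (m : ℕ) (w : List ℕ) : (word w).map (shift m) = word (shift m w) := rfl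

lemma map_shift_concat (m : ℕ) (M N : WordSum) :
    (M ⬝ N).map (shift m) = M.map (shift m) ⬝ N.map (shift m) := by
  simp [concat, Multiset.map_bind, Multiset.bind_map, shift, Function.comp_def]

lemma map_shift_sh (m : ℕ) (M N : WordSum) :
    (M ⧢ N).map (shift m) = M.map (shift m) ⧢ N.map (shift m) := by
  have h : ∀ u v, (shuffle u v).map (shift m) = shuffle (shift m u) (shift m v) :=
    fun u v => (shuffle_map _ u v).symm
  simp only [sh, Multiset.map_bind, Multiset.bind_map, h]

lemma map_shift_delta (r n m : ℕ) : (delta n m).map (shift r) = delta (n + r) (m + r) := by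
  rcases Nat.lt_or_ge (n + 1) m with h | h
  · rw [delta_eq_zero h, delta_eq_zero (by omega), Multiset.map_zero]
  · rw [delta_eq_word h, delta_eq_word (by omega), map_shift_word, shift, List.map_reverse,
      show n + r + 1 - (m + r) = n + 1 - m by omega]
    congr 2
    have := List.map_add_range' (a := r) m (n + 1 - m) 1
    rw [add_comm m r, ← this]
    exact List.map_congr_left fun x _ => add_comm x r

end WordSum

/-! ### Standardization -/

lemma standardize_of_pairwise_lt {w : List ℕ} (h : w.Pairwise (· < ·)) :
    standardize w = List.range' 1 w.length := by
  have hp := isPermWord_standardize (w := w) (h.imp fun h => h.ne)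
  have hl : (standardize w).length = w.length := by simp [standardize]
  have hs : (standardize w).Pairwise (· < ·) := by
    rw [standardize, List.pairwise_map]
    exact h.imp_of_mem fun _ hb hab => countP_lt_countP hb hab
  rw [IsPermWord, hl] at hp
  exact hp.eq_of_pairwise (fun _ _ _ _ h₁ h₂ => absurd h₁ (lt_asymm h₂)) hs
    (List.pairwise_lt_range' _)

lemma standardize_cons_of_length_lt {u : List ℕ} (hu : IsPermWord u) {a : ℕ}
    (ha : u.length < a) : standardize (a :: u) = (u.length + 1) :: u := by
  rw [standardize, List.map_cons, List.countP_cons]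
  congr 1
  · have : u.countP (· ≤ a) = u.length := List.countP_eq_length.2 fun x hx => by
      have := hu.le hx
      simp
      omega
    simp [this]
  · conv_rhs => rw [← standardize_eq_self hu, standardize]
    refine List.map_congr_left fun x hx => ?_
    have := hu.le hx
    rw [List.countP_cons_of_neg]
    simp
    omega

lemma isPermWord_range' (m : ℕ) : IsPermWord (List.range' 1 m) := by
  simp [IsPermWord]

lemma isPermWord_two_one (m : ℕ) : IsPermWord (2 :: 1 :: List.range' 3 m) := by
  rw [isPermWord_iff]
  refine ⟨?_, fun x hx => ?_⟩
  · simp [List.nodup_range']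
  · simp at hx ⊢
    omega

lemma IsPermWord.cons_append_range' {c : List ℕ} (hc : IsPermWord c) {s : ℕ} (hs : c.length = s)
    (d : ℕ) : IsPermWord ((s + 1) :: (c ++ List.range' (s + 2) d)) := by
  subst hs
  rw [isPermWord_iff]
  refine ⟨?_, fun x hx => ?_⟩
  · rw [List.nodup_cons, List.nodup_append]
    refine ⟨fun h => ?_, hc.nodup, List.nodup_range', fun x hx y hy => ?_⟩
    · rcases List.mem_append.1 h with h | h
      · have := hc.le h
        omega
      · simp at h
    · have := hc.le hx
      simp at hy
      omega
  · simp at hx ⊢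
    rcases hx with rfl | hx | hx
    · omega
    · have := hc.le hx
      have := hc.pos hx
      omega
    · omega

/-! ### The antipode on words -/

section Antipode

variable (k : Type*) [CommRing k]

/-- The operator `w ↦ u ⧢ (w + m)` on combinations of words, where `m` is the length of `u`. -/
noncomputable def shuffleShift (u : List ℕ) : (List ℕ →₀ k) →ₗ[k] (List ℕ →₀ k) :=
  Finsupp.linearCombination k fun w => toFinsupp k (shuffle u (shift u.length w))

lemma shuffleShift_toFinsupp (u : List ℕ) (M : WordSum) :
    shuffleShift k u (toFinsupp k M) = toFinsupp k (word u ⧢ M.map (shift u.length)) := by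
  induction M using Multiset.induction with
  | empty => simp [sh_zero]
  | cons w M ih =>
    rw [← Multiset.singleton_add, map_add, map_add, ih, Multiset.map_add, sh_add, map_add]
    congr 1
    change shuffleShift k u (toFinsupp k (word w)) = toFinsupp k (word u ⧢ word _)
    rw [toFinsupp_word, word_sh_word]
    simp [shuffleShift]

lemma shuffleShift_delta (u : List ℕ) {i m n : ℕ} (hi : u.length = i) (hn : i + m = n) :
    shuffleShift k u (toFinsupp k (delta m 1)) = toFinsupp k (word u ⧢ delta n (i + 1)) := by
  rw [shuffleShift_toFinsupp, map_shift_delta, hi, ← hn, add_comm i, add_comm i]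

lemma toWords_ofWord {w : List ℕ} (hw : IsPermWord w) :
    SSym.toWords k (SSym.ofWord k w) = Finsupp.single w 1 := by
  rw [SSym.ofWord, dif_pos hw, SSym.toWords, Module.Basis.constr_basis]

lemma toWords_basis_mul (p : PermWord) (y : SSym k) :
    SSym.toWords k (SSym.basis k p * y) = shuffleShift k p.word (SSym.toWords k y) := by
  induction y using SSym.induction_basis with
  | hadd x y hx hy => rw [mul_add, map_add, map_add, map_add, hx, hy]
  | hsmul c x hx => rw [mul_smul_comm, map_smul, map_smul, map_smul, hx]
  | hb q =>
    rw [SSym.basis_mul_basis', ← SSym.ofWord_val k q, toWords_ofWord k q.2, ← toFinsupp_word,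
      shuffleShift_toFinsupp, map_shift_word, word_sh_word]
    change (SSym.toWords k).toAddMonoidHom _ = _
    rw [SSym.map_shSum, shSum, toFinsupp_apply]
    refine congrArg _ (Multiset.map_congr rfl fun w hw => ?_)
    exact toWords_ofWord k (isPermWord_of_mem_shuffle p.2 q.2 hw)

/-- The antipode of a permutation, expanded into words. -/
noncomputable def antipodeWords (w : List ℕ) : List ℕ →₀ k :=
  SSym.toWords k (HopfAlgebra.antipode k (SSym.ofWord k w))

lemma antipodeWords_nil : antipodeWords k [] = Finsupp.single [] 1 := by
  have h : SSym.ofWord k [] = SSym.basis k PermWord.empty := SSym.ofWord_val k PermWord.empty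
  have h' : HopfAlgebra.antipode k (SSym.basis k PermWord.empty) =
      SSym.basis k PermWord.empty := by
    change SSym.antipodeMap k _ = _
    rw [SSym.antipodeMap, Module.Basis.constr_basis, SSym.antipodeBasis,
      if_pos (show PermWord.empty.length = 0 from rfl)]
  rw [antipodeWords, h, h', ← h, toWords_ofWord k isPermWord_nil]

/-- The recursion `S(w) = -∑_{i ≥ 1} st(w₁ ⋯ wᵢ) · S(st(wᵢ₊₁ ⋯ wₙ))`, coming from the fact that
the antipode is a right convolution inverse of the identity. -/
lemma antipodeWords_eq_neg_sum {w : List ℕ} (hw : IsPermWord w) (h0 : w.length ≠ 0) :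
    antipodeWords k w = -∑ i ∈ Finset.range w.length,
      shuffleShift k (standardize (w.take (i + 1)))
        (antipodeWords k (standardize (w.drop (i + 1)))) := by
  have hb : ∀ p : PermWord, HopfAlgebra.antipode k (SSym.basis k p) =
      SSym.antipodeBasis' k p := by
    intro p
    change SSym.antipodeMap k _ = _
    rw [SSym.antipodeMap_eq, SSym.antipodeMap', Module.Basis.constr_basis]
  have hp : SSym.ofWord k w = SSym.basis k ⟨w, hw⟩ := SSym.ofWord_val k ⟨w, hw⟩
  rw [antipodeWords, hp, hb, SSym.antipodeBasis',
    if_neg (show ¬PermWord.length ⟨w, hw⟩ = 0 from h0), map_neg, map_sum,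
    ← Fin.sum_univ_eq_sum_range fun i => shuffleShift k (standardize (w.take (i + 1)))
        (antipodeWords k (standardize (w.drop (i + 1))))]
  congr 1
  refine Finset.sum_congr rfl fun i _ => ?_
  rw [toWords_basis_mul, ← hb, ← SSym.ofWord_val]
  rfl

lemma antipodeWords_range' (n : ℕ) :
    antipodeWords k (List.range' 1 n) = (-1 : k) ^ n • toFinsupp k (delta n 1) := by
  induction n using Nat.strong_induction_on with
  | _ n ih =>
  rcases n with _ | d
  · rw [List.range'_zero, antipodeWords_nil, delta_self, toFinsupp_word, pow_zero, one_smul]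
  rw [antipodeWords_eq_neg_sum k (isPermWord_range' _) (by simp), List.length_range']
  have hs : ∀ i ∈ Finset.range (d + 1),
      shuffleShift k (standardize ((List.range' 1 (d + 1)).take (i + 1)))
        (antipodeWords k (standardize ((List.range' 1 (d + 1)).drop (i + 1)))) =
      (-1 : k) ^ d • ((-1 : k) ^ i • toFinsupp k
        (word ([] ++ [1] ++ List.range' (1 + 1) i) ⧢ delta (1 + d) (1 + i + 1))) := by
    intro i hi
    rw [Finset.mem_range] at hi
    have hd : standardize ((List.range' 1 (d + 1)).drop (i + 1)) = List.range' 1 (d - i) := by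
      rw [standardize_of_pairwise_lt ((List.pairwise_lt_range' _).sublist
        (List.drop_sublist _ _))]
      simp
    have ht : standardize ((List.range' 1 (d + 1)).take (i + 1)) = [1] ++ List.range' 2 i := by
      rw [standardize_of_pairwise_lt ((List.pairwise_lt_range' _).sublist
        (List.take_sublist _ _)), List.length_take, List.length_range',
        min_eq_left (by omega), List.range'_succ]
      rfl
    rw [hd, ht, ih _ (by omega), map_smul, shuffleShift_delta k _ (i := 1 + i) (n := 1 + d)
      (by simp [add_comm]) (by omega), smul_smul, ← pow_add, List.nil_append]
    congr 1
    rw [show d + i = d - i + 2 * i by omega, pow_add, pow_mul]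
    simp
  rw [Finset.sum_congr rfl hs, ← Finset.smul_sum, sum_sh_delta_telescope, word_nil_sh,
    ← delta_eq_concat (by omega), add_comm 1 d, pow_succ]
  simp

/-- The terms of the recursion for the antipode whose suffix is increasing. -/
lemma shuffleShift_antipodeWords_drop {w : List ℕ} {i m : ℕ} (hi : i + m = w.length)
    (h : (w.drop i).Pairwise (· < ·)) :
    shuffleShift k (standardize (w.take i)) (antipodeWords k (standardize (w.drop i))) =
      (-1 : k) ^ m • toFinsupp k (word (standardize (w.take i)) ⧢ delta w.length (i + 1)) := by
  rw [standardize_of_pairwise_lt h, antipodeWords_range', map_smul, List.length_drop,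
    shuffleShift_delta k _ (i := i) (n := w.length) (by simp [standardize]; omega) (by omega),
    show w.length - i = m by omega]

/-- The antipode of `(s+1) c (s+2) ⋯ n`, where `c` is a permutation of `1, …, s` ending in `x`. If
the letters after the first `r + 1` are increasing, then the recursion is explicit but for its
first `r` terms, and its terms with a prefix longer than `s` telescope. -/
lemma antipodeWords_cons_append_range' {c c' : List ℕ} (hc : IsPermWord c) {x : ℕ}
    (hx : c = c' ++ [x]) (r e d : ℕ) (hl : c.length = r + e)
    (h : ((c ++ List.range' (r + e + 2) d).drop r).Pairwise (· < ·)) :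
    antipodeWords k ((r + e + 1) :: (c ++ List.range' (r + e + 2) d)) =
      -∑ i ∈ Finset.range r,
        shuffleShift k (standardize ((r + e + 1) :: c.take i))
          (antipodeWords k (standardize ((c ++ List.range' (r + e + 2) d).drop i))) +
      (-1 : k) ^ (e + 1 + d) • (∑ i ∈ Finset.range e, (-1 : k) ^ i • toFinsupp k
          (word (standardize ((r + e + 1) :: c.take (r + i))) ⧢
            delta (r + e + 1 + d) (r + i + 2)) +
        (-1 : k) ^ e • toFinsupp k ((word ((r + e + 1) :: c') ⧢
          delta (r + e + 1 + d) (r + e + 2)) ⬝ word [x])) := by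
  have hp := hc.cons_append_range' hl d
  set w := (r + e + 1) :: (c ++ List.range' (r + e + 2) d) with hw
  have hn : w.length = r + e + 1 + d := by
    simp [w, hl]
    omega
  have htake : ∀ i ≤ r + e, w.take (i + 1) = (r + e + 1) :: c.take i := by
    intro i hi
    rw [hw, List.take_succ_cons, List.take_append_of_le_length (by omega)]
  have hterm : ∀ i < e + (d + 1),
      shuffleShift k (standardize (w.take (r + i + 1)))
        (antipodeWords k (standardize (w.drop (r + i + 1)))) =
      -((-1 : k) ^ (e + 1 + d) • ((-1 : k) ^ i • toFinsupp k
        (word (standardize (w.take (r + i + 1))) ⧢ delta (r + e + 1 + d) (r + i + 2)))) := by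
    intro i hi
    rw [shuffleShift_antipodeWords_drop k (m := e + d - i) (by omega), hn, smul_smul, ← pow_add,
      ← neg_smul]
    · congr 1
      rw [show e + 1 + d + i = e + d - i + 2 * i + 1 by omega, pow_succ, pow_add, pow_mul]
      simp
    · rw [hw, List.drop_succ_cons, ← List.drop_drop]
      exact h.sublist (List.drop_sublist _ _)
  rw [antipodeWords_eq_neg_sum k hp (by omega), hn,
    show r + e + 1 + d = r + (e + (d + 1)) by omega, Finset.sum_range_add, neg_add]
  congr 1
  · congr 1
    refine Finset.sum_congr rfl fun i hi => ?_
    rw [Finset.mem_range] at hi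
    rw [htake i (by omega), hw, List.drop_succ_cons]
  · rw [Finset.sum_congr rfl fun i hi => hterm i (Finset.mem_range.1 hi),
      Finset.sum_neg_distrib, neg_neg, ← Finset.smul_sum, Finset.sum_range_add]
    refine congrArg _ (congrArg₂ _ ?_ ?_)
    · refine Finset.sum_congr rfl fun i hi => ?_
      rw [Finset.mem_range] at hi
      rw [htake _ (by omega), show r + (e + (d + 1)) = r + e + 1 + d by omega]
    · have ht := sum_sh_delta_telescope k d (r + e + 1) ((r + e + 1) :: c') x
      rw [show r + (e + (d + 1)) = r + e + 1 + d by omega, ← ht, Finset.smul_sum]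
      refine Finset.sum_congr rfl fun i hi => ?_
      rw [Finset.mem_range] at hi
      have hti : w.take (r + (e + i) + 1) = (r + e + 1) :: (c ++ List.range' (r + e + 2) i) := by
        rw [hw, List.take_succ_cons, show r + (e + i) = c.length + i by omega,
          List.take_length_add_append, List.take_range'_of_length_ge (by omega)]
      rw [hti, standardize_eq_self (hc.cons_append_range' hl i), smul_smul, ← pow_add, hx]
      simp [add_assoc, add_comm, add_left_comm]

end Antipode

/-! ### Expansions of shuffles by their last letters -/

namespace WordSum

lemma sh_assoc (M N P : WordSum) : M ⧢ N ⧢ P = M ⧢ (N ⧢ P) := by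
  have h : ∀ u v w : List ℕ, ((shuffle u v).bind fun x => shuffle x w) =
      (shuffle v w).bind fun y => shuffle u y := by
    intro u v w
    have := shSum_assoc u v w fun x => ({x} : Multiset (List ℕ))
    simp only [shSum, Multiset.sum_map_singleton] at this
    exact this
  simp only [sh, Multiset.bind_assoc]
  refine Multiset.bind_congr fun u _ => Multiset.bind_congr fun v _ => ?_
  rw [Multiset.bind_bind]
  exact Multiset.bind_congr fun w _ => h u v w

lemma word_sh_concat (M : WordSum) (x y : ℕ) :
    word [x] ⧢ M ⬝ word [y] = M ⬝ word [y] ⬝ word [x] + (word [x] ⧢ M) ⬝ word [y] := by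
  have h := concat_sh_concat (word []) M x y
  rwa [word_concat_word, List.nil_append, word_nil_sh] at h

lemma word_singleton_sh_delta (x : ℕ) {n m : ℕ} (h : m ≤ n + 1) :
    word [x] ⧢ delta n m = delta n m ⬝ word [x] + (word [x] ⧢ delta n (m + 1)) ⬝ word [m] := by
  simpa only [List.nil_append, word_nil_sh] using word_concat_sh_delta [] x h

lemma word_pair_sh_delta (x y : ℕ) {n m : ℕ} (h : m ≤ n + 1) :
    word [x, y] ⧢ delta n m =
      (word [x] ⧢ delta n m) ⬝ word [y] + (word [x, y] ⧢ delta n (m + 1)) ⬝ word [m] :=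
  word_concat_sh_delta [x] y h

lemma word_two_sh_delta_concat {n : ℕ} (hn : 2 ≤ n) :
    (word [2] ⧢ delta n 3) ⬝ word [1] =
      (word [2] ⧢ delta n 4) ⬝ word [3, 1] + delta n 2 ⬝ word [1] := by
  rw [word_singleton_sh_delta _ (by omega), ← delta_eq_concat hn, add_concat, concat_assoc,
    word_concat_word, List.singleton_append, add_comm]

lemma word_three_two_sh_delta_concat {n : ℕ} (hn : 3 ≤ n) :
    (word [3, 2] ⧢ delta n 4) ⬝ word [1] = delta n 3 ⬝ word [2, 1] +
      (word [3] ⧢ delta n 5) ⬝ word [4, 2, 1] + (word [3, 2] ⧢ delta n 5) ⬝ word [4, 1] := by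
  rw [word_pair_sh_delta _ _ (by omega), word_singleton_sh_delta _ (by omega),
    ← delta_eq_concat hn]
  simp only [add_concat, concat_assoc, word_concat_word, List.cons_append, List.nil_append,
    Nat.reduceAdd]

lemma word_two_one_sh_delta {n : ℕ} (hn : 2 ≤ n) :
    word [2, 1] ⧢ delta n 3 = delta n 3 ⬝ word [2, 1] +
      (word [2] ⧢ delta n 4) ⬝ word [3, 1] + (word [2, 1] ⧢ delta n 4) ⬝ word [3] := by
  rw [word_pair_sh_delta _ _ (by omega), word_singleton_sh_delta _ (by omega)]
  simp only [add_concat, concat_assoc, word_concat_word, List.singleton_append]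

lemma word_one_sh_concat_four_two (M : WordSum) :
    word [1] ⧢ M ⬝ word [4, 2] = M ⬝ word [4, 2, 1] + (word [1] ⧢ M ⬝ word [4]) ⬝ word [2] := by
  have h : M ⬝ word [4, 2] = M ⬝ word [4] ⬝ word [2] := by
    rw [concat_assoc, word_concat_word, List.singleton_append]
  rw [h, word_sh_concat]
  simp only [concat_assoc, word_concat_word, List.cons_append, List.nil_append]

lemma word_one_sh_two_sh_concat (M : WordSum) :
    word [1] ⧢ (word [2] ⧢ M) ⬝ word [3] = (word [2] ⧢ M) ⬝ word [3, 1] +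
      (word [1, 2] ⧢ M) ⬝ word [3] + (word [2, 1] ⧢ M) ⬝ word [3] := by
  have h : word [1] ⧢ word [2] = word [1, 2] + word [2, 1] := by
    rw [word_sh_word]
    simp [shuffle, word]
  rw [word_sh_concat, ← sh_assoc, h, add_sh, add_concat, concat_assoc, word_concat_word,
    List.singleton_append, add_assoc]

end WordSum

/-! ### Rearrangements of alternating sums -/

section Alternating

variable {k V : Type*} [CommRing k] [AddCommGroup V] [Module k V]

/-- If the shuffle with the prefix of length `r + 2` splits by its last letter as
`G r + F (r + 1)`, and that with the prefix of length `1` as `D + F 0`, this collects `F r` and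
`G (r + 1)`, whose words have the same last letter `r + 2`. -/
lemma sum_alternating_regroup (F G : ℕ → V) (D : V) (c : ℕ) :
    ∑ r ∈ Finset.range c, (-1 : k) ^ (r + 1) • (G r + F (r + 1)) + (-1 : k) ^ 0 • (D + F 0) +
      (-1 : k) ^ (c + 1) • G c =
      D - G 0 + (-1 : k) ^ c • F c + ∑ r ∈ Finset.range c, (-1 : k) ^ r • (F r + G (r + 1)) := by
  induction c with
  | zero => simp; abel
  | succ c ih =>
    rw [Finset.sum_range_succ, Finset.sum_range_succ, ← sub_eq_zero]
    rw [← sub_eq_zero] at ih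
    rw [← ih]
    module

/-- If the shuffle with the prefix of length `r + 3` splits by its last letter as `G r + F r`, this
collects `F r` and `G (r + 1)`, which have opposite signs. -/
lemma sum_alternating_shift (F G : ℕ → V) (c : ℕ) :
    ∑ r ∈ Finset.range c, (-1 : k) ^ (r + 1) • (G r + F r) + (-1 : k) ^ (c + 1) • G c =
      -(∑ r ∈ Finset.range c, (-1 : k) ^ r • (F r - G (r + 1)) + G 0) := by
  induction c with
  | zero => simp
  | succ c ih =>
    rw [Finset.sum_range_succ, Finset.sum_range_succ, ← sub_eq_zero]
    rw [← sub_eq_zero] at ih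
    rw [← ih]
    module

end Alternating

/-! ### The antipode of `σ_A` in the free module on words -/

section Formulas

variable (k : Type*) [CommRing k]

/-- The word of this lemma is `σ_{a}` with `a = c + 2` and `n = c + 2 + d`. -/
lemma antipodeWords_singleton (c d n : ℕ) (hn : n = c + 2 + d) :
    antipodeWords k ((c + 2) :: (List.range' 1 (c + 1) ++ List.range' (c + 3) d)) =
      (-1 : k) ^ n •
        (-toFinsupp k ((word [2] ⧢ delta n 4) ⬝ word [3, 1]) +
          (-1 : k) ^ c • toFinsupp k
            ((word ((c + 1) :: List.range' 1 c) ⧢ delta n (c + 3)) ⬝ word [c + 2]) +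
          ∑ r ∈ Finset.range c, (-1 : k) ^ r •
            (toFinsupp k ((word ((r + 1) :: List.range' 1 r) ⧢ delta n (r + 3)) ⬝ word [r + 2]) +
              toFinsupp k ((word ((r + 3) :: List.range' 1 (r + 1)) ⧢ delta n (r + 4)) ⬝
                word [r + 2]))) := by
  have hcat : ∀ r, List.range' 1 (r + 1) = List.range' 1 r ++ [r + 1] := fun r =>
    List.range'_1_concat.trans (by rw [add_comm])
  have h := antipodeWords_cons_append_range' k (isPermWord_range' (c + 1)) (hcat c) 0 (c + 1) d
    (by simp) (by
      rw [List.drop_zero, List.pairwise_append]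
      refine ⟨List.pairwise_lt_range' _, List.pairwise_lt_range' _, fun x hx y hy => ?_⟩
      simp at hx hy
      omega)
  simp only [Finset.range_zero, Finset.sum_empty, neg_zero, zero_add,
    show c + 1 + 1 + d = n by omega] at h
  -- Each shuffle is split by its last letter, which comes from the prefix or from `δ`.
  have hT : ∀ r < c, toFinsupp k (word (standardize ((c + 1 + 1) ::
      (List.range' 1 (c + 1)).take (r + 1))) ⧢ delta n (r + 1 + 2)) =
      toFinsupp k ((word ((r + 2) :: List.range' 1 r) ⧢ delta n (r + 3)) ⬝ word [r + 1]) +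
      toFinsupp k ((word ((r + 1 + 1) :: List.range' 1 (r + 1)) ⧢ delta n (r + 1 + 3)) ⬝
        word [r + 1 + 2]) := by
    intro r hr
    rw [List.take_range'_of_length_ge (by omega),
      standardize_cons_of_length_lt (isPermWord_range' _) (by simp; omega), List.length_range',
      hcat, ← List.cons_append, word_concat_sh_delta _ _ (by omega), map_add]
  have hT0 : toFinsupp k (word (standardize ((c + 1 + 1) ::
      (List.range' 1 (c + 1)).take 0)) ⧢ delta n 2) =
      toFinsupp k (delta n 2 ⬝ word [1]) +
        toFinsupp k ((word ((0 + 1) :: List.range' 1 0) ⧢ delta n (0 + 3)) ⬝ word [0 + 2]) := by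
    rw [List.take_zero, standardize_cons_of_length_lt isPermWord_nil (by simp), List.length_nil,
      word_singleton_sh_delta _ (by omega), map_add, List.range'_zero, zero_add, zero_add, zero_add]
  rw [h, Finset.sum_range_succ', Finset.sum_congr rfl fun r hr => by
    rw [hT r (Finset.mem_range.1 hr)], zero_add, hT0]
  refine congrArg _ ((sum_alternating_regroup (fun r => toFinsupp k
    ((word ((r + 1) :: List.range' 1 r) ⧢ delta n (r + 3)) ⬝ word [r + 2])) (fun r => toFinsupp k
    ((word ((r + 2) :: List.range' 1 r) ⧢ delta n (r + 3)) ⬝ word [r + 1])) _ c).trans ?_)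
  simp only [List.range'_zero, zero_add, word_two_sh_delta_concat (show 2 ≤ n by omega), map_add]
  abel

/-- The first term of the recursion for `S(σ_{a,2})`, where `a = c + 3` and `n = c + 3 + d`. It
involves the antipode of `2 1 3 ⋯ (n-1)`, which is `σ_{2}`. -/
lemma shuffleShift_antipodeWords_two_one (c d n : ℕ) (hn : n = c + 3 + d) :
    shuffleShift k (standardize [c + 3])
      (antipodeWords k (standardize (2 :: 1 :: List.range' 3 c ++ List.range' (c + 4) d))) =
      (-1 : k) ^ n • (toFinsupp k (word [1] ⧢ (word [3] ⧢ delta n 5) ⬝ word [4, 2]) -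
        toFinsupp k (word [1] ⧢ (word [2] ⧢ delta n 4) ⬝ word [3])) := by
  -- The letters of the suffix are those of `2 1 3 ⋯ (n-1)` with a gap at `a = c + 3`.
  have hmap : 2 :: 1 :: List.range' 3 c ++ List.range' (c + 4) d =
      (2 :: 1 :: List.range' 3 (c + d)).map fun x => if c + 3 ≤ x then x + 1 else x := by
    rw [← List.range'_append_1]
    simp only [List.map_cons, List.map_append, List.cons_append]
    rw [if_neg (by omega), if_neg (by omega)]
    congr 3
    · refine ((List.map_congr_left fun x hx => ?_).trans (List.map_id _)).symm
      simp at hx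
      rw [if_neg (by omega), id]
    · rw [show c + 4 = 1 + (3 + c) by omega, ← List.map_add_range']
      refine List.map_congr_left fun x hx => ?_
      simp at hx
      rw [if_pos (by omega), add_comm]
  have hst : standardize (2 :: 1 :: List.range' 3 c ++ List.range' (c + 4) d) =
      2 :: 1 :: List.range' 3 (c + d) := by
    rw [hmap, standardize_map _ _ fun x _ y _ => by split_ifs <;> omega,
      standardize_eq_self (isPermWord_two_one _)]
  have hs : antipodeWords k (2 :: 1 :: List.range' 3 (c + d)) = _ :=
    antipodeWords_singleton k 0 (c + d) (c + 2 + d) (by omega)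
  rw [hst, hs, standardize_cons_of_length_lt isPermWord_nil (by simp)]
  simp only [Finset.range_zero, Finset.sum_empty, add_zero, pow_zero, one_smul, map_smul, map_add,
    map_neg, shuffleShift_toFinsupp, map_shift_concat, map_shift_sh, map_shift_delta,
    map_shift_word, List.length_singleton, List.length_nil, zero_add, shift, List.map_cons,
    List.map_nil, List.range'_zero, Nat.reduceAdd]
  rw [show n = c + 2 + d + 1 by omega, pow_succ]
  module

/-- The word of this lemma is `σ_{a,2}` with `a = c + 3` and `n = c + 3 + d`. -/
lemma antipodeWords_pair (c d n : ℕ) (hn : n = c + 3 + d) :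
    antipodeWords k ((c + 3) :: (2 :: 1 :: List.range' 3 c ++ List.range' (c + 4) d)) =
      (-1 : k) ^ n •
        (toFinsupp k ((word [3, 2] ⧢ delta n 5) ⬝ word [4, 1]) +
          toFinsupp k ((word [1, 2] ⧢ delta n 4) ⬝ word [3]) -
          toFinsupp k ((word [1] ⧢ (word [3] ⧢ delta n 5) ⬝ word [4]) ⬝ word [2]) +
          ∑ r ∈ Finset.range c, (-1 : k) ^ r •
            (toFinsupp k ((word ((r + 3) :: 2 :: 1 :: List.range' 3 r) ⧢ delta n (r + 5)) ⬝
                word [r + 4]) -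
              toFinsupp k ((word ((r + 4) :: 2 :: 1 :: List.range' 3 r) ⧢ delta n (r + 5)) ⬝
                word [r + 3]))) := by
  -- The word `2 1 3 ⋯ (r+2)` is `u r` followed by its last letter `x r`, which is `1` for `r = 0`.
  obtain ⟨u, x, hux, hu0, hx0, hu, hx⟩ : ∃ (u : ℕ → List ℕ) (x : ℕ → ℕ),
      (∀ r, 2 :: 1 :: List.range' 3 r = u r ++ [x r]) ∧ u 0 = [2] ∧ x 0 = 1 ∧
      (∀ r, u (r + 1) = 2 :: 1 :: List.range' 3 r) ∧ ∀ r, x (r + 1) = r + 3 := by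
    refine ⟨fun r => Nat.casesOn r [2] fun r => 2 :: 1 :: List.range' 3 r,
      fun r => Nat.casesOn r 1 fun r => r + 3, fun r => ?_, rfl, rfl, fun _ => rfl, fun _ => rfl⟩
    cases r with
    | zero => rfl
    | succ r => simp [List.range'_concat, add_comm]
  have h := antipodeWords_cons_append_range' k (isPermWord_two_one c) (hux c) 1 (c + 1) d
    (by simp; omega) (by
      rw [List.cons_append, List.drop_succ_cons, List.drop_zero, List.cons_append,
        List.pairwise_cons, List.pairwise_append]
      refine ⟨fun x hx => ?_, List.pairwise_lt_range' _, List.pairwise_lt_range' _,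
        fun x hx y hy => ?_⟩
      · simp at hx
        omega
      · simp at hx hy
        omega)
  simp only [show 1 + (c + 1) + 2 = c + 4 by omega, show 1 + (c + 1) + 1 = c + 3 by omega,
    Finset.sum_range_one, List.take_zero, List.drop_zero, ← hn] at h
  -- Each shuffle is split by its last letter, which comes from the prefix or from `δ`.
  have hT : ∀ r < c, toFinsupp k (word (standardize ((c + 3) ::
      (2 :: 1 :: List.range' 3 c).take (1 + (r + 1)))) ⧢ delta n (1 + (r + 1) + 2)) =
      toFinsupp k ((word ((r + 3) :: u r) ⧢ delta n (r + 4)) ⬝ word [x r]) +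
      toFinsupp k ((word ((r + 3) :: 2 :: 1 :: List.range' 3 r) ⧢ delta n (r + 5)) ⬝
        word [r + 4]) := by
    intro r hr
    rw [show 1 + (r + 1) = r + 2 by omega, List.take_succ_cons, List.take_succ_cons,
      List.take_range'_of_length_ge (by omega),
      standardize_cons_of_length_lt (isPermWord_two_one _) (by simp; omega),
      ← map_add, hux, ← List.cons_append, ← List.cons_append, ← hux,
      show (2 :: 1 :: List.range' 3 r).length + 1 = r + 3 by simp,
      ← word_concat_sh_delta _ _ (by omega)]
  have hT0 : standardize ((c + 3) :: (2 :: 1 :: List.range' 3 c).take (1 + 0)) = [2, 1] := by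
    simp [standardize]
  have hG0 : (word ((0 + 3) :: u 0) ⧢ delta n (0 + 4)) ⬝ word [x 0] = _ :=
    (by rw [hu0, hx0] : _ = (word [3, 2] ⧢ delta n 4) ⬝ word [1]).trans
      (word_three_two_sh_delta_concat (by omega))
  have hsum := sum_alternating_shift (k := k)
    (fun r => toFinsupp k ((word ((r + 3) :: 2 :: 1 :: List.range' 3 r) ⧢ delta n (r + 5)) ⬝
      word [r + 4]))
    (fun r => toFinsupp k ((word ((r + 3) :: u r) ⧢ delta n (r + 4)) ⬝ word [x r])) c
  have hG : ∀ r, (word ((r + 1 + 3) :: u (r + 1)) ⧢ delta n (r + 1 + 4)) ⬝ word [x (r + 1)] =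
      (word ((r + 4) :: 2 :: 1 :: List.range' 3 r) ⧢ delta n (r + 5)) ⬝ word [r + 3] :=
    fun r => by rw [hu, hx]
  simp only [hG0, hG] at hsum
  have hpow : (-1 : k) ^ (c + 1 + 1 + d) = -(-1 : k) ^ n := by
    rw [show n = c + 1 + 1 + d + 1 by omega, pow_succ, mul_neg_one, neg_neg]
  rw [h, shuffleShift_antipodeWords_two_one k c d n hn, Finset.sum_range_succ',
    Finset.sum_congr rfl fun r hr => by rw [hT r (Finset.mem_range.1 hr)], hT0,
    add_right_comm (_ : List ℕ →₀ k), hsum, hpow, word_two_one_sh_delta (by omega),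
    word_one_sh_concat_four_two,
    word_one_sh_two_sh_concat]
  simp only [map_add]
  module

end Formulas

/-! ### The words of the permutations `σ_A` -/

lemma sort_eq_of_pairwise_lt {s : Finset ℕ} {l : List ℕ} (hl : l.Pairwise (· < ·))
    (h : ∀ x, x ∈ l ↔ x ∈ s) : s.sort (· ≤ ·) = l := by
  refine List.Perm.eq_of_pairwise (le := (· ≤ ·)) (fun _ _ _ _ => le_antisymm)
    (Finset.pairwise_sort _ _) (hl.imp fun h => h.le) ?_
  rw [List.perm_ext_iff_of_nodup (Finset.sort_nodup _ _) (hl.imp fun h => h.ne)]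
  simp [h]

lemma sort_pair {a b : ℕ} (h : b < a) : ({a, b} : Finset ℕ).sort (· ≥ ·) = [a, b] := by
  rw [Finset.sort_insert (· ≥ ·) (by simpa using h.le) (by simpa using h.ne'),
    Finset.sort_singleton]

lemma pairwise_lt_range'_append_range' {p q r s : ℕ} (h : p + q ≤ r) :
    (List.range' p q ++ List.range' r s).Pairwise (· < ·) := by
  rw [List.pairwise_append]
  refine ⟨List.pairwise_lt_range' _, List.pairwise_lt_range' _, fun x hx y hy => ?_⟩
  simp at hx hy
  omega

lemma sigmaWord_singleton (c d : ℕ) :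
    sigmaWord (c + 2 + d) {c + 2} =
      (c + 2) :: (List.range' 1 (c + 1) ++ List.range' (c + 3) d) := by
  rw [sigmaWord, Finset.sort_singleton, List.singleton_append, sort_eq_of_pairwise_lt
    (pairwise_lt_range'_append_range' (p := 1) (q := c + 1) (r := c + 3) (s := d) (by omega))
    fun x => ?_]
  simp
  omega

lemma sigmaWord_pair_one (c d : ℕ) :
    sigmaWord (c + 2 + d) {c + 2, 1} =
      (c + 2) :: (List.range' 1 (c + 1) ++ List.range' (c + 3) d) := by
  rw [sigmaWord, sort_pair (by omega), sort_eq_of_pairwise_lt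
    (pairwise_lt_range'_append_range' (p := 2) (q := c) (r := c + 3) (s := d) (by omega))
    fun x => ?_, List.range'_succ]
  · rfl
  · simp
    omega

lemma sigmaWord_pair_two (c d : ℕ) :
    sigmaWord (c + 3 + d) {c + 3, 2} =
      (c + 3) :: (2 :: 1 :: List.range' 3 c ++ List.range' (c + 4) d) := by
  rw [sigmaWord, sort_pair (by omega), sort_eq_of_pairwise_lt
    (l := 1 :: (List.range' 3 c ++ List.range' (c + 4) d)) (List.pairwise_cons.2
      ⟨fun x hx => ?_, pairwise_lt_range'_append_range' (by omega)⟩) fun x => ?_]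
  · rfl
  · simp at hx
    omega
  · simp
    omega

lemma toWords_antipode_basis (k : Type*) [CommRing k] (p : PermWord) :
    SSym.toWords k (HopfAlgebra.antipode k (SSym.basis k p)) = antipodeWords k p.word := by
  rw [antipodeWords, SSym.ofWord_val]

end MalvenutoReutenauer

theorem mainTheorem2 (k : Type*) [CommRing k] :
    (∀ (n a : ℕ) (h₁ : 1 < a) (h₂ : a ≤ n),
      sigma n {a} (singleton_subset_Icc h₁ h₂) = sigma n {a, 1} (pair_subset_Icc le_rfl h₁ h₂) ∧
      IsCancellationFreeFormula
        (HopfAlgebra.antipode k (SSym.basis k (sigma n {a} (singleton_subset_Icc h₁ h₂))))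
        (signed ((-1) ^ (n - 1)) ((word [2] ⧢ delta n 4) ⬝ word [3, 1]) +
          signed ((-1) ^ (n + a))
            ((word [a - 1] ⬝ eta 1 (a - 2) ⧢ delta n (a + 1)) ⬝ word [a]) +
          ∑ j ∈ Finset.Icc 2 (a - 1),
            signed ((-1) ^ (n + j))
              ((word [j - 1] ⬝ eta 1 (j - 2) ⧢ delta n (j + 1)) ⬝ word [j] +
                (word [j + 1] ⬝ eta 1 (j - 1) ⧢ delta n (j + 2)) ⬝ word [j]))) ∧
    (∀ (n a : ℕ) (h₁ : 2 < a) (h₂ : a ≤ n),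
      IsCancellationFreeFormula
        (HopfAlgebra.antipode k
          (SSym.basis k (sigma n {a, 2} (pair_subset_Icc one_le_two h₁ h₂))))
        (signed ((-1) ^ n)
            ((word [3, 2] ⧢ delta n 5) ⬝ word [4, 1] + (word [1, 2] ⧢ delta n 4) ⬝ word [3]) +
          signed ((-1) ^ (n - 1))
            ((word [1] ⧢ (word [3] ⧢ delta n 5) ⬝ word [4]) ⬝ word [2]) +
          ∑ j ∈ Finset.Icc 3 (a - 1),
            (signed ((-1) ^ (n + j))
                ((word [j + 1, 2, 1] ⬝ eta 3 (j - 1) ⧢ delta n (j + 2)) ⬝ word [j]) +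
              signed (-(-1) ^ (n + j))
                ((word [j, 2, 1] ⬝ eta 3 (j - 1) ⧢ delta n (j + 2)) ⬝ word [j + 1])))) := by
  refine ⟨fun n a h₁ h₂ => ⟨?_, ?_, ?_⟩, fun n a h₁ h₂ => ⟨?_, ?_⟩⟩
  · obtain ⟨c, rfl⟩ := Nat.exists_eq_add_of_le' h₁
    obtain ⟨d, rfl⟩ := Nat.exists_eq_add_of_le h₂
    exact PermWord.ext ((sigmaWord_singleton c d).trans (sigmaWord_pair_one c d).symm)
  · obtain ⟨c, rfl⟩ := Nat.exists_eq_add_of_le' h₁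
    obtain ⟨d, hd⟩ := Nat.exists_eq_add_of_le h₂
    have hw : (sigma n {c + 2} (singleton_subset_Icc h₁ h₂)).word =
        (c + 2) :: (List.range' 1 (c + 1) ++ List.range' (c + 3) d) := by
      subst hd
      exact sigmaWord_singleton c d
    have heta : ∀ i j, word [i] ⬝ eta 1 j = word (i :: List.range' 1 j) := fun i j => by
      rw [eta_eq_word (by omega), word_concat_word]
      rfl
    have hsgn : (-1 : k) ^ (n - 1) = -(-1 : k) ^ n := by
      rw [show n = n - 1 + 1 by omega, pow_succ]
      simp
    rw [toWords_antipode_basis, hw, antipodeWords_singleton k c d n hd, eval_add, eval_add,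
      eval_sum, ← Finset.Ico_add_one_right_eq_Icc, Finset.sum_Ico_eq_sum_range]
    simp only [eval_signed, Units.val_pow_eq_pow_val, Units.val_neg, Units.val_one, Int.cast_pow,
      Int.cast_neg, Int.cast_one, hsgn, heta]
    rw [show c + 2 - 1 + 1 - 2 = c by omega, smul_add, smul_add, Finset.smul_sum, smul_neg,
      neg_smul, smul_smul, ← pow_add, show n + (c + 2) = n + c + 2 by omega, pow_add _ _ 2,
      neg_one_sq, mul_one]
    refine congrArg _ (Finset.sum_congr rfl fun r _ => ?_)
    rw [smul_smul, ← pow_add, show n + (2 + r) = n + r + 2 by omega, pow_add _ _ 2, neg_one_sq,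
      mul_one, map_add, show 2 + r = r + 2 by omega]
    rfl
  · -- The sign of a word is determined by its last letter.
    refine cancellationFree_of_sign (fun w => (-1) ^ (n + w.getLast?.getD 0)) fun t ht => ?_
    have hsgn : (-1 : ℤˣ) ^ (n - 1) = (-1) ^ (n + 1) := by
      rw [show n + 1 = n - 1 + 2 by omega, pow_add _ _ 2]
      simp
    simp only [Multiset.mem_add, Multiset.mem_sum, mem_signed] at ht
    rcases ht with (⟨hs, hw⟩ | ⟨hs, hw⟩) | ⟨j, hj, hs, hw | hw⟩
    · rw [hs, getLast?_of_mem_concat (v := [3]) hw, hsgn]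
      rfl
    all_goals
      rw [hs, getLast?_of_mem_concat (v := []) hw]
      rfl
  · obtain ⟨c, rfl⟩ := Nat.exists_eq_add_of_le' h₁
    obtain ⟨d, hd⟩ := Nat.exists_eq_add_of_le h₂
    have hw : (sigma n {c + 3, 2} (pair_subset_Icc one_le_two h₁ h₂)).word =
        (c + 3) :: (2 :: 1 :: List.range' 3 c ++ List.range' (c + 4) d) := by
      subst hd
      exact sigmaWord_pair_two c d
    have heta : ∀ i r, word [i, 2, 1] ⬝ eta 3 (3 + r - 1) =
        word (i :: 2 :: 1 :: List.range' 3 r) := fun i r => by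
      rw [eta_eq_word (by omega), word_concat_word, show 3 + r - 1 + 1 - 3 = r by omega]
      rfl
    have hsgn : (-1 : k) ^ (n - 1) = -(-1 : k) ^ n := by
      rw [show n = n - 1 + 1 by omega, pow_succ]
      simp
    rw [toWords_antipode_basis, hw, antipodeWords_pair k c d n hd, eval_add, eval_add,
      eval_sum, ← Finset.Ico_add_one_right_eq_Icc, Finset.sum_Ico_eq_sum_range]
    simp only [eval_signed, eval_add, Units.val_pow_eq_pow_val, Units.val_neg, Units.val_one,
      Int.cast_pow, Int.cast_neg, Int.cast_one, hsgn, heta, map_add]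
    rw [show c + 3 - 1 + 1 - 3 = c by omega, smul_add, Finset.smul_sum, smul_sub, neg_smul,
      ← sub_eq_add_neg]
    refine congrArg _ (Finset.sum_congr rfl fun r _ => ?_)
    rw [pow_add _ n, pow_add _ 3, show 3 + r = r + 3 by omega]
    module
  · -- The words ending in `3` are told apart by the order of the letters `1` and `2`.
    refine cancellationFree_of_sign (fun w =>
      if w.getLast?.getD 0 = 3 ∧ w.filter (· ≤ 2) = [1, 2] then (-1) ^ n
      else if w.getLast?.getD 0 ≤ 2 then (-1) ^ (n + w.getLast?.getD 0 + 1)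
      else (-1) ^ (n + w.getLast?.getD 0)) fun t ht => ?_
    have hsgn : (-1 : ℤˣ) ^ (n - 1) = (-1) ^ (n + 2 + 1) := by
      rw [show n + 2 + 1 = n - 1 + 2 * 2 by omega, pow_add, pow_mul]
      simp
    have hfilter : ∀ {u w : List ℕ} {x m : ℕ}, 2 < x → 2 ≤ m →
        w ∈ (word u ⧢ delta n (m + 1)) ⬝ word [x] → w.filter (· ≤ 2) = u.filter (· ≤ 2) := by
      intro u w x m hx hm hw
      rw [concat_word, Multiset.mem_map] at hw
      obtain ⟨v, hv, rfl⟩ := hw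
      rw [List.filter_append, filter_of_mem_sh_delta hv hm]
      simpa using hx
    simp only [Multiset.mem_add, Multiset.mem_sum, mem_signed, Finset.mem_Icc] at ht
    rcases ht with (⟨hs, hw | hw⟩ | ⟨hs, hw⟩) | ⟨j, hj, ⟨hs, hw⟩ | ⟨hs, hw⟩⟩
    · rw [hs, getLast?_of_mem_concat (v := [4]) hw]
      simp [pow_add]
    · rw [hs, getLast?_of_mem_concat (v := []) hw, hfilter (by omega) (by omega) hw]
      simp
    · rw [hs, getLast?_of_mem_concat (v := []) hw, hsgn]
      simp
    · rw [hs, getLast?_of_mem_concat (v := []) hw]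
      rw [eta_eq_word (by omega), word_concat_word] at hw
      rw [hfilter (by omega) (by omega) hw, if_neg, if_neg]
      · rfl
      · simp
        omega
      · rintro ⟨-, h⟩
        simp [show ¬j + 1 ≤ 2 by omega] at h
    · rw [hs, getLast?_of_mem_concat (v := []) hw, if_neg, if_neg]
      · simp [pow_add]
      · simp
        omega
      · simp
        omega
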